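/- An \emph{MV-algebra} is a commutative monoid $(A,\oplus,0)$ with an operation $\neg$ such that, with $1=\neg 0$, $\neg\neg a=a$, $a\oplus 1=1$ and $\neg(\neg a\oplus b)\oplus b=\neg(\neg b\oplus a)\oplus a$ (the one-element algebra is allowed); morphisms preserve $0,\oplus,\neg$. Put $a\odot b=\neg(\neg a\oplus\neg b)$, $a\ominus b=\neg(\neg a\oplus b)$, and $a\le b$ iff $\neg a\oplus b=1$. An ideal of $A$ is a subset containing $0$, closed under $\oplus$ and downward closed; a prime ideal is a proper ideal $P$ with $a\ominus b\in P$ or $b\ominus a\in P$ for all $a,b$; $Sp(A)$ is the set of prime ideals, and for $P\in Sp(A)$ the quotient $A/P$ is a nontrivial totally ordered MV-algebra. An \emph{$l_u$-group} $(G,u)$ is an abelian lattice-ordered group with an element $u\ge 0$ such that every $x\in G$ satisfies $|x|\le nu$ for some $n\in\mathbb N$; morphisms are the group homomorphisms that preserve $\vee$, $\wedge$ and $u$. $Sp(G)$ is the set of proper convex $l$-subgroups $P$ with $G/P$ totally ordered. $\Gamma(G,u)=[0,u]$, with $x\oplus y=u\wedge(x+y)$ and $\neg x=u-x$, is an MV-algebra,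 and restriction of morphisms makes $\Gamma$ a functor from $l_u$-groups to MV-algebras. For a nontrivial totally ordered MV-algebra $C$, let $C^*$ be the set of pairs $(m,a)\in\mathbb Z\times C$ with $(m+1,0)$ identified with $(m,1)$, ordered lexicographically, with $(m,a)+(n,b)=(m+n,a\oplus b)$ if $a\oplus b<1$ and $(m,a)+(n,b)=(m+n+1,a\odot b)$ if $a\oplus b=1$, and $-(m,a)=(-m-1,\neg a)$. Put $\imath(a)=(0,a)$, and $f^*(m,a)=(m,f(a))$ for a morphism $f$ of such algebras. For an arbitrary MV-algebra $A$ and $a\in A$ let $\imath\hat a\in\prod_{P\in Sp(A)}(A/P)^*$ be the element $P\mapsto\imath([a]_P)$, and let $A^*$ be the subgroup of this product (with its pointwise operations and order) generated by $\{\imath\hat a: a\in A\}$; it is an $l_u$-group with strong unit $u=\imath\hat 1$. \textbf{Theorem.} For a morphism $h:A\to B$ of MV-algebras and $P\in Sp(B)$ let $h|_P:A/h^{-1}P\to B/P$ be the morphism $[a]\mapsto[h(a)]$, and define $h^*:\prod_{P\in Sp(A)}(A/P)^*\to\prod_{P\in Sp(B)}(B/P)^*$ by $h^*(\sigma)(P)=(h|_P)^*(\sigma(h^{-1}P))$.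 Then: (1) $h^*$ is a morphism of $l$-groups, and it restricts to a morphism of $l_u$-groups $h^*:A^*\to B^*$. (2) With these morphisms, $(-)^*$ is a functor from MV-algebras to $l_u$-groups. (3) The maps $A\to\Gamma(A^*,u)$, $a\mapsto\imath\hat a$, form a natural isomorphism $\mathrm{Id}\cong\Gamma\circ(-)^*$. (4) There is a natural isomorphism $\upsilon:\Gamma(G,u)^*\to(G,u)$ given fiberwise by Chang's maps $(m,a)\mapsto mu+a$: if $s\in\Gamma(G,u)^*$, $P\in Sp(G)$, $m\in\mathbb Z$, $a\in[0,u]$ and $s(P\cap[0,u])=(m,[a]_{P\cap[0,u]})$, then $[\upsilon(s)]_P=m[u]_P+[a]_P$ in $G/P$. In particular $\upsilon(\imath\hat x)=x$ for every $x\in\Gamma(G,u)$. (5) Hence $\Gamma$ is an equivalence between the category of $l_u$-groups and the category of MV-algebras. -/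

import Mathlib

open CategoryTheory

universe v w

/-! ## MV-algebras -/

/-- An MV-algebra, written additively: `a + b` is `a ⊕ b`, `aᶜ` is `¬ a`, and the top element
`1` is `0ᶜ`. The one-element MV-algebra is allowed. -/
class MVAlgebra (A : Type v) extends AddCommMonoid A, Compl A where
  neg_neg : ∀ a : A, aᶜᶜ = a
  add_one : ∀ a : A, a + 0ᶜ = 0ᶜ
  lukasiewicz : ∀ a b : A, (aᶜ + b)ᶜ + b = (bᶜ + a)ᶜ + a

/-- Morphisms of MV-algebras. -/
@[ext] structure MVHom (A : Type v) (B : Type w) [MVAlgebra A] [MVAlgebra B] where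
  toFun : A → B
  map_zero : toFun 0 = 0
  map_add : ∀ a b, toFun (a + b) = toFun a + toFun b
  map_compl : ∀ a, toFun aᶜ = (toFun a)ᶜ

namespace MVAlgebra

variable {A : Type v} [MVAlgebra A]

/-- `a ⊙ b = ¬(¬a ⊕ ¬b)`. -/
def odot (a b : A) : A := (aᶜ + bᶜ)ᶜ

/-- `a ⊖ b = a ⊙ ¬b = ¬(¬a ⊕ b)`. -/
def ominus (a b : A) : A := (aᶜ + b)ᶜ

/-- The natural order: `a ≤ b` iff `¬a ⊕ b = 1`. -/
def le (a b : A) : Prop := aᶜ + b = 0ᶜ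

theorem add_compl (a : A) : a + aᶜ = 0ᶜ := by
  have h := lukasiewicz (0ᶜ : A) a
  rw [add_one, neg_neg, zero_add, add_comm aᶜ a] at h
  exact h

theorem compl_inj {a b : A} (h : aᶜ = bᶜ) : a = b := by
  rw [← neg_neg a, h, neg_neg]

theorem le_refl (a : A) : le a a := by rw [le, add_comm, add_compl]

theorem add_ominus_of_le {a b : A} (h : le a b) : a + ominus b a = b := by
  have h1 := lukasiewicz a b
  unfold le at h
  rw [h, neg_neg, zero_add] at h1
  rw [add_comm]; exact h1.symm

theorem le_antisymm {a b : A} (h : le a b) (h' : le b a) : a = b := by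
  have h1 := lukasiewicz a b
  unfold le at h h'
  rw [h, h', neg_neg, zero_add, zero_add] at h1
  exact h1.symm

theorem le_add (a b : A) : le a (a + b) := by
  rw [le, ← add_assoc, add_comm aᶜ a, add_compl, add_comm, add_one]

theorem le_trans {a b c : A} (h : le a b) (h' : le b c) : le a c := by
  rw [← add_ominus_of_le h', ← add_ominus_of_le h, add_assoc]
  exact le_add _ _

theorem ominus_le_iff {a b c : A} : le (ominus a b) c ↔ le a (b + c) := by
  unfold le ominus
  rw [neg_neg, add_assoc]

theorem zero_le (a : A) : le 0 a := by rw [le, add_comm, add_one]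

theorem le_one (a : A) : le a 0ᶜ := add_one _

theorem eq_one_of_le {a b : A} (h : le a b) (ha : a = 0ᶜ) : b = 0ᶜ :=
  le_antisymm (le_one _) (ha ▸ h)

theorem eq_zero_of_le {a b : A} (h : le a b) (hb : b = 0) : a = 0 :=
  le_antisymm (hb ▸ h) (zero_le _)

theorem add_le_add {a b c d : A} (h : le a b) (h' : le c d) : le (a + c) (b + d) := by
  rw [← add_ominus_of_le h, ← add_ominus_of_le h', add_add_add_comm]
  exact le_add _ _

theorem compl_le {a b : A} (h : le a b) : le bᶜ aᶜ := by
  rw [le, neg_neg, add_comm]; exact h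

theorem odot_le {a b c d : A} (h : le a b) (h' : le c d) : le (odot a c) (odot b d) :=
  compl_le (add_le_add (compl_le h) (compl_le h'))

theorem odot_comm (a b : A) : odot a b = odot b a := by unfold odot; rw [add_comm]

theorem odot_assoc (a b c : A) : odot (odot a b) c = odot a (odot b c) := by
  unfold odot; rw [neg_neg, neg_neg, add_assoc]

theorem odot_le_left (a b : A) : le (odot a b) a := by
  have h := compl_le (le_add aᶜ bᶜ)
  rwa [neg_neg] at h

theorem odot_le_right (a b : A) : le (odot a b) b := odot_comm a b ▸ odot_le_left b a

theorem odot_one (a : A) : odot a 0ᶜ = a := by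
  unfold odot; rw [neg_neg, add_zero, neg_neg]

theorem odot_compl (a : A) : odot a aᶜ = 0 := by
  unfold odot; rw [add_compl, neg_neg]

theorem odot_eq_zero {a b : A} : odot a b = 0 ↔ le a bᶜ := by
  unfold odot le
  constructor
  · intro h; rw [← h, neg_neg]
  · intro h; rw [h, neg_neg]

/-- If `a ⊙ b = 0` then `¬a = b ⊕ ¬(a ⊕ b)`. -/
theorem compl_eq {a b : A} (h : odot a b = 0) : aᶜ = b + (a + b)ᶜ := by
  have h1 : le b aᶜ := by rw [← odot_eq_zero, odot_comm]; exact h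
  have h2 := add_ominus_of_le h1
  unfold ominus at h2
  rw [neg_neg] at h2
  exact h2.symm

theorem odot_add_eq {a b d : A} (h : odot a b = 0) (h' : odot b d = 0) :
    odot (a + b) d = odot a (b + d) := by
  have h1 := compl_eq h
  have h2 := compl_eq ((odot_comm d b).trans h')
  unfold odot
  rw [h1, h2, add_comm d b]
  congr 1
  rw [← add_assoc, add_comm (a + b)ᶜ b]

theorem add_odot_eq {a b d : A} (h : a + b = 0ᶜ) (h' : b + d = 0ᶜ) :
    odot a b + d = a + odot b d := by
  have h1 : odot aᶜ bᶜ = 0 := by unfold odot; rw [neg_neg, neg_neg, h, neg_neg]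
  have h2 : odot bᶜ dᶜ = 0 := by unfold odot; rw [neg_neg, neg_neg, h', neg_neg]
  have h3 := odot_add_eq h1 h2
  unfold odot at h3 ⊢
  rw [neg_neg, neg_neg] at h3
  exact compl_inj h3

theorem add_odot_eq_odot {a b d : A} (h : odot a b = 0) (h' : b + d = 0ᶜ) :
    odot (a + b) d = a + odot b d := by
  -- write `e = b ⊙ d`, `f = b ⊖ e = ¬d`, `p = ¬(a ⊕ b)`
  have hbd : odot bᶜ dᶜ = 0 := by unfold odot; rw [neg_neg, neg_neg, h', neg_neg]
  have hb : b = dᶜ + odot b d := by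
    have := compl_eq hbd
    rw [neg_neg] at this
    exact this
  have ha := compl_eq h
  have e1 : odot (a + b)ᶜ dᶜ = 0 := by
    rw [odot_eq_zero]
    have k1 : le dᶜ b := by rw [le, neg_neg, add_comm]; exact h'
    have k2 : le b (a + b) := by rw [add_comm]; exact le_add _ _
    exact compl_le (le_trans k1 k2)
  have e2 : odot dᶜ (odot b d) = 0 := by
    rw [odot_comm, odot_assoc, odot_compl]
    exact eq_zero_of_le (odot_le_right b 0) rfl
  have e3 := odot_add_eq e1 e2
  rw [← hb] at e3
  have e4 : odot (a + b)ᶜ b = 0 := by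
    rw [odot_comm, odot_eq_zero, neg_neg, add_comm]; exact le_add _ _
  rw [e4] at e3
  -- both sides are complements of `p ⊕ ¬d`
  have e5 : le ((a + b)ᶜ + dᶜ) (odot b d)ᶜ := odot_eq_zero.1 e3
  have e6 : odot b d + a = ((a + b)ᶜ + dᶜ)ᶜ := by
    have h1 := compl_eq e3
    have h2 : (a + b)ᶜ + dᶜ + odot b d = aᶜ := by
      rw [ha, add_assoc, ← hb, add_comm]
    rw [h2, neg_neg] at h1
    exact h1.symm
  rw [add_comm a (odot b d), e6]
  rfl

theorem odot_ne {a b : A} (h : a ≠ 0ᶜ) : odot a b ≠ 0ᶜ :=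
  fun h' => h (eq_one_of_le (odot_le_left a b) h')

end MVAlgebra

open MVAlgebra

/-! ## Chang's group of an MV-chain -/

/-- A (nontrivial) MV-chain. -/
class MVChain (A : Type v) [MVAlgebra A] : Prop where
  zero_ne_one : (0 : A) ≠ 0ᶜ
  total : ∀ a b : A, le a b ∨ le b a

/-- The set `A*` of all pairs `(m, a)`, `m ∈ ℤ`, `a ∈ A`, with `(m + 1, 0)` identified with
`(m, 1)`. It is encoded by normal forms: each class contains exactly one pair with `a ≠ 1`. -/
@[ext] structure Chang (A : Type v) [MVAlgebra A] where
  lvl : ℤ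
  val : A
  val_ne : val ≠ 0ᶜ

namespace Chang

variable {A : Type v} [MVAlgebra A] [MVChain A]

open Classical in
/-- The class of the pair `(m, a)`, so that `pair m 1 = pair (m + 1) 0`. -/
noncomputable def pair (m : ℤ) (a : A) : Chang A :=
  if h : a = 0ᶜ then ⟨m + 1, 0, MVChain.zero_ne_one⟩ else ⟨m, a, h⟩

theorem pair_one (m : ℤ) : pair m (0ᶜ : A) = pair (m + 1) 0 := by
  rw [pair, dif_pos rfl, pair, dif_neg MVChain.zero_ne_one]

theorem pair_of_ne (m : ℤ) {a : A} (h : a ≠ 0ᶜ) : pair m a = ⟨m, a, h⟩ := by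
  rw [pair, dif_neg h]

theorem pair_eta (x : Chang A) : pair x.lvl x.val = x := pair_of_ne _ x.val_ne

noncomputable instance : Zero (Chang A) := ⟨pair 0 0⟩

open Classical in
noncomputable instance : Add (Chang A) :=
  ⟨fun x y => if x.val + y.val = 0ᶜ then pair (x.lvl + y.lvl + 1) (odot x.val y.val)
    else pair (x.lvl + y.lvl) (x.val + y.val)⟩

noncomputable instance : Neg (Chang A) := ⟨fun x => pair (-x.lvl - 1) x.valᶜ⟩

/-- The lexicographic order. -/
noncomputable instance : LinearOrder (Chang A) where
  le x y := x.lvl < y.lvl ∨ (x.lvl = y.lvl ∧ MVAlgebra.le x.val y.val)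
  le_refl x := Or.inr ⟨rfl, MVAlgebra.le_refl _⟩
  le_trans x y z := by
    rintro (h | ⟨h, h'⟩) (k | ⟨k, k'⟩)
    · exact Or.inl (h.trans k)
    · exact Or.inl (k ▸ h)
    · exact Or.inl (h ▸ k)
    · exact Or.inr ⟨h.trans k, MVAlgebra.le_trans h' k'⟩
  le_antisymm x y := by
    rintro (h | ⟨h, h'⟩) (k | ⟨k, k'⟩)
    · omega
    · omega
    · omega
    · exact Chang.ext h (MVAlgebra.le_antisymm h' k')
  le_total x y := by
    rcases lt_trichotomy x.lvl y.lvl with h | h | h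
    · exact Or.inl (Or.inl h)
    · rcases MVChain.total x.val y.val with k | k
      · exact Or.inl (Or.inr ⟨h, k⟩)
      · exact Or.inr (Or.inr ⟨h.symm, k⟩)
    · exact Or.inr (Or.inl h)
  toDecidableLE := Classical.decRel _

theorem le_def (x y : Chang A) :
    x ≤ y ↔ x.lvl < y.lvl ∨ (x.lvl = y.lvl ∧ MVAlgebra.le x.val y.val) := Iff.rfl

theorem zero_def : (0 : Chang A) = ⟨0, 0, MVChain.zero_ne_one⟩ :=
  pair_of_ne _ MVChain.zero_ne_one

theorem add_of_eq (x y : Chang A) (h : x.val + y.val = 0ᶜ) :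
    x + y = ⟨x.lvl + y.lvl + 1, odot x.val y.val, odot_ne x.val_ne⟩ := by
  refine Eq.trans (if_pos h) (pair_of_ne _ _)

theorem add_of_ne (x y : Chang A) (h : x.val + y.val ≠ 0ᶜ) :
    x + y = ⟨x.lvl + y.lvl, x.val + y.val, h⟩ := by
  refine Eq.trans (if_neg h) (pair_of_ne _ _)

theorem odot_eq_zero_of_ne {a b : A} (h : a + b ≠ 0ᶜ) : odot a b = 0 := by
  rw [odot_eq_zero]
  rcases MVChain.total a bᶜ with k | k
  · exact k
  · exfalso; apply h
    unfold MVAlgebra.le at k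
    rw [MVAlgebra.neg_neg] at k
    rw [add_comm]; exact k

theorem add_comm' (x y : Chang A) : x + y = y + x := by
  by_cases h : x.val + y.val = 0ᶜ
  · have h' : y.val + x.val = 0ᶜ := by rw [add_comm]; exact h
    rw [add_of_eq x y h, add_of_eq y x h']
    ext
    · simp only; ring
    · exact odot_comm _ _
  · have h' : y.val + x.val ≠ 0ᶜ := by rw [add_comm]; exact h
    rw [add_of_ne x y h, add_of_ne y x h']
    ext
    · simp only; ring
    · exact add_comm _ _

theorem add_assoc_aux (x y z : Chang A) (h1 : x.val + y.val ≠ 0ᶜ) (h2 : y.val + z.val = 0ᶜ) :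
    x + y + z = x + (y + z) := by
  have e := add_odot_eq_odot (odot_eq_zero_of_ne h1) h2
  have k1 : x.val + y.val + z.val = 0ᶜ := by rw [add_assoc, h2, add_one]
  have k2 : x.val + odot y.val z.val ≠ 0ᶜ := by rw [← e]; exact odot_ne h1
  rw [add_of_ne x y h1, add_of_eq y z h2, add_of_eq _ z k1, add_of_ne x _ k2]
  ext
  · simp only; ring
  · exact e

theorem add_assoc' (x y z : Chang A) : x + y + z = x + (y + z) := by
  by_cases h1 : x.val + y.val = 0ᶜ <;> by_cases h2 : y.val + z.val = 0ᶜ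
  · have e := add_odot_eq h1 h2
    rw [add_of_eq x y h1, add_of_eq y z h2]
    by_cases h3 : odot x.val y.val + z.val = 0ᶜ
    · rw [add_of_eq _ z h3, add_of_eq x _ (e ▸ h3)]
      ext
      · simp only; ring
      · exact odot_assoc _ _ _
    · rw [add_of_ne _ z h3, add_of_ne x _ (e ▸ h3)]
      ext
      · simp only; ring
      · exact e
  · rw [add_comm' (x + y), add_comm' x y, add_comm' x, add_comm' y z]
    refine (add_assoc_aux z y x ?_ ?_).symm
    · rw [add_comm]; exact h2
    · rw [add_comm]; exact h1
  · exact add_assoc_aux x y z h1 h2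
  · have e := odot_add_eq (odot_eq_zero_of_ne h1) (odot_eq_zero_of_ne h2)
    have e' := add_assoc x.val y.val z.val
    rw [add_of_ne x y h1, add_of_ne y z h2]
    by_cases h3 : x.val + y.val + z.val = 0ᶜ
    · rw [add_of_eq _ z h3, add_of_eq x _ (e' ▸ h3)]
      ext
      · simp only; ring
      · exact e
    · rw [add_of_ne _ z h3, add_of_ne x _ (e' ▸ h3)]
      ext
      · simp only; ring
      · exact e'

theorem zero_add' (x : Chang A) : 0 + x = x := by
  have h : (0 : Chang A).val + x.val ≠ 0ᶜ := by
    rw [zero_def]; simp only [zero_add]; exact x.val_ne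
  rw [add_of_ne _ _ h]
  ext <;> simp [zero_def]

theorem neg_add' (x : Chang A) : -x + x = 0 := by
  by_cases h0 : x.val = 0
  · have h1 : -x = ⟨-x.lvl, 0, MVChain.zero_ne_one⟩ := by
      refine (pair_one_of x h0)
    have h : (-x).val + x.val ≠ 0ᶜ := by
      rw [h1]; simp only [zero_add]; exact x.val_ne
    rw [add_of_ne _ _ h]
    ext <;> simp [zero_def, h1, h0]
  · have hne : x.valᶜ ≠ 0ᶜ := fun h => h0 (compl_inj h)
    have h1 : -x = ⟨-x.lvl - 1, x.valᶜ, hne⟩ := pair_of_ne _ hne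
    have h : (-x).val + x.val = 0ᶜ := by
      rw [h1, add_comm]; exact add_compl _
    rw [add_of_eq _ _ h]
    ext
    · simp only [zero_def, h1]; ring
    · simp only [zero_def, h1]; rw [odot_comm, odot_compl]
where
  pair_one_of (x : Chang A) (h0 : x.val = 0) : -x = ⟨-x.lvl, 0, MVChain.zero_ne_one⟩ := by
    have : -x = pair (-x.lvl - 1) x.valᶜ := rfl
    rw [this, h0, pair_one, pair_of_ne _ MVChain.zero_ne_one]
    ext
    · simp only; ring
    · rfl

noncomputable instance : AddCommGroup (Chang A) where
  add_assoc := add_assoc'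
  zero_add := zero_add'
  add_zero x := by rw [add_comm', zero_add']
  add_comm := add_comm'
  neg_add_cancel := neg_add'
  nsmul := nsmulRec
  zsmul := zsmulRec

instance : IsOrderedAddMonoid (Chang A) where
  add_le_add_left x y hxy z := by
    by_cases h1 : x.val + z.val = 0ᶜ <;> by_cases h2 : y.val + z.val = 0ᶜ
    · rw [add_of_eq x z h1, add_of_eq y z h2, le_def]
      rcases hxy with h | ⟨h, h'⟩
      · left; simp only; omega
      · exact Or.inr ⟨by simp only; omega, odot_le h' (MVAlgebra.le_refl _)⟩
    · rw [add_of_eq x z h1, add_of_ne y z h2, le_def]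
      rcases hxy with h | ⟨h, h'⟩
      · rcases (Int.add_one_le_of_lt h).lt_or_eq with k | k
        · left; simp only; omega
        · refine Or.inr ⟨by simp only; omega, MVAlgebra.le_trans (odot_le_right x.val z.val) ?_⟩
          show MVAlgebra.le z.val (y.val + z.val)
          rw [add_comm]; exact le_add _ _
      · exact absurd (eq_one_of_le (MVAlgebra.add_le_add h' (MVAlgebra.le_refl _)) h1) h2
    · rw [add_of_ne x z h1, add_of_eq y z h2, le_def]
      rcases hxy with h | ⟨h, h'⟩ <;> (left; simp only; omega)
    · rw [add_of_ne x z h1, add_of_ne y z h2, le_def]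
      rcases hxy with h | ⟨h, h'⟩
      · left; simp only; omega
      · exact Or.inr ⟨by simp only; omega, MVAlgebra.add_le_add h' (MVAlgebra.le_refl _)⟩

theorem pair_add_pair_of_ne (m n : ℤ) {a b : A} (h : a + b ≠ 0ᶜ) :
    pair m a + pair n b = pair (m + n) (a + b) := by
  have ha : a ≠ 0ᶜ := fun k => h (eq_one_of_le (le_add a b) k)
  have hb : b ≠ 0ᶜ := fun k => h (by rw [k, add_one])
  rw [pair_of_ne m ha, pair_of_ne n hb, pair_of_ne _ h, add_of_ne _ _ h]

theorem pair_add_pair_of_eq (m n : ℤ) {a b : A} (h : a + b = 0ᶜ) :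
    pair m a + pair n b = pair (m + n + 1) (odot a b) := by
  have key : ∀ (m n : ℤ) (b : A), pair m (0ᶜ : A) + pair n b = pair (m + n + 1) b := by
    intro m n b
    have h0 : (0 : A) ≠ 0ᶜ := MVChain.zero_ne_one
    by_cases hb : b = 0ᶜ
    · subst hb
      rw [pair_one, pair_one, pair_one, pair_add_pair_of_ne _ _ (by rwa [add_zero]), add_zero]
      congr 1; ring
    · rw [pair_one, pair_add_pair_of_ne _ _ (by rwa [zero_add]), zero_add]
      congr 1; ring
  by_cases ha : a = 0ᶜ
  · subst ha
    rw [key, odot_comm, odot_one]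
  · by_cases hb : b = 0ᶜ
    · subst hb
      rw [add_comm, key, odot_one]
      congr 1; ring
    · rw [pair_of_ne m ha, pair_of_ne n hb, add_of_eq _ _ h, pair_of_ne _ (odot_ne ha)]

/-- `ı(a) = (0, a)`. -/
noncomputable def iota (a : A) : Chang A := pair 0 a

/-- The strong unit `(0, 1)`. -/
noncomputable def unit : Chang A := pair 0 0ᶜ

theorem pair_le_pair (m : ℤ) {a b : A} (h : MVAlgebra.le a b) : pair m a ≤ pair m b := by
  by_cases hb : b = 0ᶜ
  · by_cases ha : a = 0ᶜ
    · rw [ha, hb]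
    · rw [pair_of_ne m ha, hb, pair_one, pair_of_ne _ MVChain.zero_ne_one, le_def]
      left; simp only; omega
  · have ha : a ≠ 0ᶜ := fun k => hb (eq_one_of_le h k)
    rw [pair_of_ne m ha, pair_of_ne m hb, le_def]
    exact Or.inr ⟨rfl, h⟩

theorem unit_eq : (unit : Chang A) = pair 1 0 := by
  unfold unit; rw [pair_one, zero_add]

theorem iota_le_unit (a : A) : iota a ≤ unit := pair_le_pair 0 (le_one a)

theorem iota_nonneg (a : A) : 0 ≤ iota a := pair_le_pair 0 (MVAlgebra.zero_le a)

theorem iota_add (a b : A) : iota (a + b) = (iota a + iota b) ⊓ unit := by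
  by_cases h : a + b = 0ᶜ
  · rw [h]
    symm
    apply inf_eq_right.2
    unfold iota
    rw [pair_add_pair_of_eq _ _ h, unit_eq]
    exact pair_le_pair _ (MVAlgebra.zero_le _)
  · symm
    have e : iota a + iota b = iota (a + b) := by
      unfold iota; rw [pair_add_pair_of_ne _ _ h]; rfl
    rw [e]
    exact inf_eq_left.2 (iota_le_unit _)

theorem iota_compl (a : A) : iota aᶜ = unit - iota a := by
  rw [eq_sub_iff_add_eq]
  unfold iota
  rw [pair_add_pair_of_eq _ _ (by rw [add_comm, add_compl]), unit_eq, odot_comm, odot_compl]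
  rfl

/-- `f*(m, a) = (m, f(a))` for a morphism `f` of MV-chains. -/
noncomputable def map {B : Type w} [MVAlgebra B] [MVChain B] (f : MVHom A B) (x : Chang A) :
    Chang B := pair x.lvl (f.toFun x.val)

end Chang

/-! ## Ideals, prime ideals and quotients of MV-algebras -/

/-- An ideal of an MV-algebra. -/
@[ext] structure MVIdeal (A : Type v) [MVAlgebra A] where
  carrier : Set A
  zero_mem : 0 ∈ carrier
  add_mem : ∀ {a b : A}, a ∈ carrier → b ∈ carrier → a + b ∈ carrier
  mem_of_le : ∀ {a b : A}, le a b → b ∈ carrier → a ∈ carrier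

/-- `Sp(A)`: the prime ideals of `A`, that is the proper ideals `P` such that `a ⊖ b ∈ P` or
`b ⊖ a ∈ P` for all `a`, `b` (so that `A/P` is totally ordered). -/
@[ext] structure MVSpec (A : Type v) [MVAlgebra A] extends MVIdeal A where
  ne_univ : carrier ≠ Set.univ
  prime : ∀ a b : A, ominus a b ∈ carrier ∨ ominus b a ∈ carrier

namespace MVIdeal

variable {A : Type v} [MVAlgebra A] (I : MVIdeal A)

theorem ominus_self (a : A) : ominus a a = 0 := by
  unfold ominus; rw [add_comm, add_compl, MVAlgebra.neg_neg]

theorem le_add_ominus (a b : A) : le a (b + ominus a b) :=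
  ominus_le_iff.1 (MVAlgebra.le_refl _)

theorem ominus_trans (a b c : A) : le (ominus a c) (ominus a b + ominus b c) := by
  rw [ominus_le_iff]
  refine MVAlgebra.le_trans (le_add_ominus a b) ?_
  refine MVAlgebra.le_trans (MVAlgebra.add_le_add (le_add_ominus b c) (MVAlgebra.le_refl _)) ?_
  rw [add_assoc, add_comm (ominus b c)]
  exact MVAlgebra.le_refl _

theorem add_ominus_add (a b c d : A) :
    le (ominus (a + b) (c + d)) (ominus a c + ominus b d) := by
  rw [ominus_le_iff, add_add_add_comm]
  exact MVAlgebra.add_le_add (le_add_ominus a c) (le_add_ominus b d)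

theorem compl_ominus_compl (a b : A) : ominus aᶜ bᶜ = ominus b a := by
  unfold ominus; rw [MVAlgebra.neg_neg, add_comm]

/-- The congruence of an ideal: `a ∼ b` iff `a ⊖ b ∈ I` and `b ⊖ a ∈ I`. -/
def setoid : Setoid A where
  r a b := ominus a b ∈ I.carrier ∧ ominus b a ∈ I.carrier
  iseqv :=
    { refl := fun a => by rw [ominus_self]; exact ⟨I.zero_mem, I.zero_mem⟩
      symm := fun h => ⟨h.2, h.1⟩
      trans := fun {a b c} h k =>
        ⟨I.mem_of_le (ominus_trans a b c) (I.add_mem h.1 k.1),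
          I.mem_of_le (ominus_trans c b a) (I.add_mem k.2 h.2)⟩ }

/-- The quotient MV-algebra `A/I`. -/
def Quot : Type v := Quotient I.setoid

/-- The class `[a]_I`. -/
def cls (a : A) : I.Quot := Quotient.mk I.setoid a

theorem cls_eq_cls {a b : A} :
    I.cls a = I.cls b ↔ ominus a b ∈ I.carrier ∧ ominus b a ∈ I.carrier :=
  Quotient.eq (r := I.setoid)

instance : Zero I.Quot := ⟨I.cls 0⟩

instance : Add I.Quot :=
  ⟨Quotient.map₂ (sa := I.setoid) (sb := I.setoid) (sc := I.setoid) (fun a b => a + b)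
    (fun a c h b d k =>
      ⟨I.mem_of_le (add_ominus_add a b c d) (I.add_mem h.1 k.1),
        I.mem_of_le (add_ominus_add c d a b) (I.add_mem h.2 k.2)⟩)⟩

instance : Compl I.Quot :=
  ⟨Quotient.map (sa := I.setoid) (sb := I.setoid) (fun a => aᶜ) (fun a b h => by
    show ominus aᶜ bᶜ ∈ I.carrier ∧ ominus bᶜ aᶜ ∈ I.carrier
    rw [compl_ominus_compl, compl_ominus_compl]
    exact ⟨h.2, h.1⟩)⟩

instance : MVAlgebra I.Quot where
  nsmul := nsmulRec
  add_assoc := by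
    rintro ⟨a⟩ ⟨b⟩ ⟨c⟩; exact congrArg I.cls (add_assoc a b c)
  zero_add := by
    rintro ⟨a⟩; exact congrArg I.cls (zero_add a)
  add_zero := by
    rintro ⟨a⟩; exact congrArg I.cls (add_zero a)
  add_comm := by
    rintro ⟨a⟩ ⟨b⟩; exact congrArg I.cls (add_comm a b)
  neg_neg := by
    rintro ⟨a⟩; exact congrArg I.cls (MVAlgebra.neg_neg a)
  add_one := by
    rintro ⟨a⟩; exact congrArg I.cls (MVAlgebra.add_one a)
  lukasiewicz := by
    rintro ⟨a⟩ ⟨b⟩; exact congrArg I.cls (lukasiewicz a b)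

theorem cls_zero : I.cls 0 = 0 := rfl
theorem cls_add (a b : A) : I.cls (a + b) = I.cls a + I.cls b := rfl
theorem cls_compl (a : A) : I.cls aᶜ = (I.cls a)ᶜ := rfl

theorem ominus_zero (a : A) : ominus a 0 = a := by
  unfold ominus; rw [add_zero, MVAlgebra.neg_neg]

theorem cls_eq_zero {a : A} : I.cls a = 0 ↔ a ∈ I.carrier := by
  rw [← cls_zero, cls_eq_cls, ominus_zero]
  refine ⟨fun h => h.1, fun h => ⟨h, I.mem_of_le ?_ I.zero_mem⟩⟩
  rw [ominus_le_iff, add_zero]; exact zero_le a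

theorem cls_le_cls {a b : A} : le (I.cls a) (I.cls b) ↔ ominus a b ∈ I.carrier := by
  rw [← cls_eq_zero]
  show (I.cls a)ᶜ + I.cls b = 0ᶜ ↔ ((I.cls a)ᶜ + I.cls b)ᶜ = 0
  constructor
  · intro h; rw [h, MVAlgebra.neg_neg]
  · intro h; rw [← h, MVAlgebra.neg_neg]

theorem one_notMem (h : I.carrier ≠ Set.univ) : (0ᶜ : A) ∉ I.carrier :=
  fun k => h (Set.eq_univ_of_forall fun a => I.mem_of_le (le_one a) k)

end MVIdeal

instance {A : Type v} [MVAlgebra A] (P : MVSpec A) : MVChain P.toMVIdeal.Quot where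
  zero_ne_one h := P.one_notMem P.ne_univ (P.toMVIdeal.cls_eq_zero.1 h.symm)
  total := by
    rintro ⟨a⟩ ⟨b⟩
    rcases P.prime a b with h | h
    · exact Or.inl (P.toMVIdeal.cls_le_cls.2 h)
    · exact Or.inr (P.toMVIdeal.cls_le_cls.2 h)

namespace MVHom

variable {A : Type v} {B : Type w} [MVAlgebra A] [MVAlgebra B]

theorem map_ominus (h : MVHom A B) (a b : A) :
    h.toFun (ominus a b) = ominus (h.toFun a) (h.toFun b) := by
  unfold ominus; rw [h.map_compl, h.map_add, h.map_compl]

theorem map_le (h : MVHom A B) {a b : A} (k : le a b) : le (h.toFun a) (h.toFun b) := by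
  unfold MVAlgebra.le at k ⊢
  rw [← h.map_compl, ← h.map_add, k, h.map_compl, h.map_zero]

/-- `h⁻¹P ∈ Sp(A)` for `P ∈ Sp(B)`. -/
def comap (h : MVHom A B) (P : MVSpec B) : MVSpec A where
  carrier := h.toFun ⁻¹' P.carrier
  zero_mem := by rw [Set.mem_preimage, h.map_zero]; exact P.zero_mem
  add_mem ha hb := by rw [Set.mem_preimage, h.map_add]; exact P.add_mem ha hb
  mem_of_le hab hb := P.mem_of_le (h.map_le hab) hb
  ne_univ k := by
    have : (0ᶜ : A) ∈ h.toFun ⁻¹' P.carrier := by rw [k]; trivial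
    rw [Set.mem_preimage, h.map_compl, h.map_zero] at this
    exact P.one_notMem P.ne_univ this
  prime a b := by
    rw [Set.mem_preimage, Set.mem_preimage, map_ominus, map_ominus]
    exact P.prime _ _

/-- `h|_P : A/h⁻¹P → B/P`, `[a] ↦ [h(a)]`. -/
def quot (h : MVHom A B) (P : MVSpec B) :
    MVHom (h.comap P).toMVIdeal.Quot P.toMVIdeal.Quot where
  toFun := Quotient.map (sa := (h.comap P).toMVIdeal.setoid) (sb := P.toMVIdeal.setoid) h.toFun
    (fun a b k => by
      show ominus (h.toFun a) (h.toFun b) ∈ P.carrier ∧ ominus (h.toFun b) (h.toFun a) ∈ P.carrier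
      rw [← map_ominus, ← map_ominus]
      exact k)
  map_zero := congrArg P.toMVIdeal.cls h.map_zero
  map_add := by
    rintro ⟨a⟩ ⟨b⟩; exact congrArg P.toMVIdeal.cls (h.map_add a b)
  map_compl := by
    rintro ⟨a⟩; exact congrArg P.toMVIdeal.cls (h.map_compl a)

end MVHom

/-! ## The group `A*` of an MV-algebra -/

section Star

variable (A : Type v) [MVAlgebra A]

/-- The `l`-group `∏_{P ∈ Sp(A)} (A/P)*`, with pointwise operations and order. -/
abbrev ChangProd : Type v := ∀ P : MVSpec A, Chang P.toMVIdeal.Quot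

variable {A}

/-- `a ↦ ı â`, where `(ı â)(P) = ı([a]_P)`. -/
noncomputable def iotaHat (a : A) : ChangProd A := fun P => Chang.iota (P.toMVIdeal.cls a)

variable (A)

/-- The strong unit `u = ı 1̂`. -/
noncomputable def starUnit : ChangProd A := iotaHat 0ᶜ

/-- `A*`: the subgroup of `∏_P (A/P)*` generated by `A° = {ı â | a ∈ A}`. -/
noncomputable def starSubgroup : AddSubgroup (ChangProd A) :=
  AddSubgroup.closure (Set.range (iotaHat (A := A)))

end Star

/-! Closure of `A*` under the lattice operations. -/

section Generation

variable {ι : Type v} {C : ι → Type w} [∀ i, AddCommGroup (C i)] [∀ i, LinearOrder (C i)]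
  [∀ i, IsOrderedAddMonoid (C i)] (u : ∀ i, C i) (S : Set (∀ i, C i))

/-- `S` is a sub-MV-algebra of the segment `[0, u]`. -/
structure IsSubMV : Prop where
  zero_mem : 0 ∈ S
  nonneg : ∀ {a}, a ∈ S → 0 ≤ a
  le_unit : ∀ {a}, a ∈ S → a ≤ u
  add_mem : ∀ {a b}, a ∈ S → b ∈ S → (a + b) ⊓ u ∈ S
  compl_mem : ∀ {a}, a ∈ S → u - a ∈ S

/-- `x` is a sum of `n` elements of `S`. -/
def SumN : ℕ → (∀ i, C i) → Prop
  | 0, x => x = 0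
  | n + 1, x => ∃ a ∈ S, ∃ y, SumN n y ∧ x = a + y

variable {u S}

theorem IsSubMV.odot_mem (h : IsSubMV u S) {a b : ∀ i, C i} (ha : a ∈ S) (hb : b ∈ S) :
    (a + b - u) ⊔ 0 ∈ S := by
  have e : (a + b - u) ⊔ 0 = u - ((u - a) + (u - b)) ⊓ u := by
    funext i
    simp only [Pi.sup_apply, Pi.inf_apply, Pi.add_apply, Pi.sub_apply, Pi.zero_apply]
    rcases le_total (u i - a i + (u i - b i)) (u i) with k | k
    · rw [inf_eq_left.2 k]
      have : u i - (u i - a i + (u i - b i)) = a i + b i - u i := by abel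
      rw [this, sup_eq_left, ← this, sub_nonneg]; exact k
    · rw [inf_eq_right.2 k, sub_self, sup_eq_right]
      have : a i + b i - u i = u i - (u i - a i + (u i - b i)) := by abel
      rw [this, sub_nonpos]; exact k
  rw [e]
  exact h.compl_mem (h.add_mem (h.compl_mem ha) (h.compl_mem hb))

theorem IsSubMV.sup_mem (h : IsSubMV u S) {a b : ∀ i, C i} (ha : a ∈ S) (hb : b ∈ S) :
    a ⊔ b ∈ S := by
  have e : a ⊔ b = ((a + (u - b) - u) ⊔ 0 + b) ⊓ u := by
    funext i
    have h1 := h.le_unit ha i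
    have h2 := h.le_unit hb i
    simp only [Pi.sup_apply, Pi.inf_apply, Pi.add_apply, Pi.sub_apply, Pi.zero_apply]
    have : a i + (u i - b i) - u i = a i - b i := by abel
    rw [this]
    rcases le_total (a i) (b i) with k | k
    · rw [sup_eq_right.2 k, sup_eq_right.2 (sub_nonpos.2 k), zero_add, inf_eq_left.2 h2]
    · rw [sup_eq_left.2 k, sup_eq_left.2 (sub_nonneg.2 k), sub_add_cancel, inf_eq_left.2 h1]
  rw [e]
  exact h.add_mem (h.odot_mem ha (h.compl_mem hb)) hb

theorem SumN.nonneg (h : IsSubMV u S) : ∀ {n : ℕ} {x : ∀ i, C i}, SumN S n x → 0 ≤ x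
  | 0, _, hx => by rw [SumN] at hx; rw [hx]
  | _ + 1, _, hx => by
    obtain ⟨a, ha, y, hy, rfl⟩ := hx
    exact add_nonneg (h.nonneg ha) (SumN.nonneg h hy)

theorem SumN.succ (h : IsSubMV u S) {n : ℕ} {x : ∀ i, C i} (hx : SumN S n x) : SumN S (n + 1) x :=
  ⟨0, h.zero_mem, x, hx, (zero_add x).symm⟩

theorem SumN.mono (h : IsSubMV u S) {n m : ℕ} (hnm : n ≤ m) {x : ∀ i, C i} (hx : SumN S n x) :
    SumN S m x := by
  induction hnm with
  | refl => exact hx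
  | step _ ih => exact SumN.succ h ih

theorem SumN.add : ∀ {n m : ℕ} {x y : ∀ i, C i}, SumN S n x → SumN S m y → SumN S (n + m) (x + y)
  | 0, m, x, y, hx, hy => by
    rw [SumN] at hx; rw [hx, zero_add, zero_add]; exact hy
  | n + 1, m, _, y, hx, hy => by
    obtain ⟨a, ha, z, hz, rfl⟩ := hx
    rw [Nat.succ_add, add_assoc]
    exact ⟨a, ha, z + y, SumN.add hz hy, rfl⟩

theorem SumN.inf_mem (h : IsSubMV u S) :
    ∀ {n : ℕ} {x : ∀ i, C i}, SumN S n x → x ⊓ u ∈ S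
  | 0, x, hx => by
    rw [SumN] at hx
    have hu : (0 : ∀ i, C i) ≤ u := h.le_unit h.zero_mem
    rw [hx, inf_eq_left.2 hu]; exact h.zero_mem
  | n + 1, _, hx => by
    obtain ⟨a, ha, y, hy, rfl⟩ := hx
    have e : (a + y) ⊓ u = (a + y ⊓ u) ⊓ u := by
      funext i
      have h1 := h.nonneg ha i
      simp only [Pi.inf_apply, Pi.add_apply, Pi.zero_apply] at h1 ⊢
      rcases le_total (y i) (u i) with k | k
      · rw [inf_eq_left.2 k]
      · rw [inf_eq_right.2 k, inf_eq_right.2 (le_add_of_nonneg_of_le h1 k),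
          inf_eq_right.2 (le_add_of_nonneg_of_le h1 le_rfl)]
    rw [e]
    exact h.add_mem ha (SumN.inf_mem h hy)

theorem SumN.sub_sup (h : IsSubMV u S) :
    ∀ {n : ℕ} {x : ∀ i, C i}, SumN S (n + 1) x → SumN S n ((x - u) ⊔ 0)
  | 0, _, hx => by
    obtain ⟨a, ha, y, hy, rfl⟩ := hx
    rw [SumN] at hy ⊢
    rw [hy, add_zero, sup_eq_right, sub_nonpos]
    exact h.le_unit ha
  | n + 1, _, hx => by
    obtain ⟨a, ha, y, hy, rfl⟩ := hx
    have e : (a + y - u) ⊔ 0 = (a + y ⊓ u - u) ⊔ 0 + (y - u) ⊔ 0 := by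
      funext i
      have h1 := h.nonneg ha i
      simp only [Pi.inf_apply, Pi.sup_apply, Pi.sub_apply, Pi.add_apply, Pi.zero_apply] at h1 ⊢
      rcases le_total (y i) (u i) with k | k
      · rw [inf_eq_left.2 k, sup_eq_right.2 (sub_nonpos.2 k), add_zero]
      · rw [inf_eq_right.2 k, sup_eq_left.2 (sub_nonneg.2 k), add_sub_cancel_right,
          sup_eq_left.2 h1, sup_eq_left.2, add_sub_assoc]
        rw [add_sub_assoc]
        exact add_nonneg h1 (sub_nonneg.2 k)
    rw [e]
    exact ⟨_, h.odot_mem ha (SumN.inf_mem h hy), _, SumN.sub_sup h hy, rfl⟩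

theorem SumN.sup (h : IsSubMV u S) :
    ∀ {n : ℕ} {x y : ∀ i, C i}, SumN S n x → SumN S n y → SumN S n (x ⊔ y)
  | 0, x, y, hx, hy => by
    rw [SumN] at hx hy ⊢
    rw [hx, hy, sup_idem]
  | n + 1, x, y, hx, hy => by
    have e : x ⊔ y = (x ⊓ u) ⊔ (y ⊓ u) + ((x - u) ⊔ 0) ⊔ ((y - u) ⊔ 0) := by
      funext i
      simp only [Pi.inf_apply, Pi.sup_apply, Pi.sub_apply, Pi.add_apply, Pi.zero_apply]
      have key : ∀ a b c : C i, a ≤ b →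
          a ⊔ b = (a ⊓ c) ⊔ (b ⊓ c) + ((a - c) ⊔ 0) ⊔ ((b - c) ⊔ 0) := by
        intro a b c hab
        have h1 : a ⊓ c ≤ b ⊓ c := inf_le_inf_right c hab
        have h2 : (a - c) ⊔ 0 ≤ (b - c) ⊔ 0 := sup_le_sup_right (sub_le_sub_right hab c) 0
        rw [sup_eq_right.2 hab, sup_eq_right.2 h1, sup_eq_right.2 h2]
        rcases le_total b c with k | k
        · rw [inf_eq_left.2 k, sup_eq_right.2 (sub_nonpos.2 k), add_zero]
        · rw [inf_eq_right.2 k, sup_eq_left.2 (sub_nonneg.2 k), add_sub_cancel]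
      rcases le_total (x i) (y i) with k | k
      · exact key _ _ _ k
      · rw [sup_comm, sup_comm (x i ⊓ u i), sup_comm ((x i - u i) ⊔ 0)]
        exact key _ _ _ k
    rw [e]
    exact ⟨_, h.sup_mem (SumN.inf_mem h hx) (SumN.inf_mem h hy), _,
      SumN.sup h (SumN.sub_sup h hx) (SumN.sub_sup h hy), rfl⟩

theorem SumN.mem_closure : ∀ {n : ℕ} {x : ∀ i, C i}, SumN S n x → x ∈ AddSubgroup.closure S
  | 0, _, hx => by rw [SumN] at hx; rw [hx]; exact zero_mem _
  | _ + 1, _, hx => by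
    obtain ⟨a, ha, y, hy, rfl⟩ := hx
    exact AddMemClass.add_mem (AddSubgroup.subset_closure ha) (SumN.mem_closure hy)

theorem exists_sumN_of_mem_closure (h : IsSubMV u S) {x : ∀ i, C i}
    (hx : x ∈ AddSubgroup.closure S) :
    ∃ n p q, SumN S n p ∧ SumN S n q ∧ x = p - q := by
  induction hx using AddSubgroup.closure_induction with
  | mem a ha =>
    exact ⟨1, a, 0, ⟨a, ha, 0, rfl, (add_zero a).symm⟩, SumN.succ h rfl, (sub_zero a).symm⟩
  | zero => exact ⟨0, 0, 0, rfl, rfl, (sub_zero 0).symm⟩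
  | add x y _ _ ihx ihy =>
    obtain ⟨n, p, q, hp, hq, rfl⟩ := ihx
    obtain ⟨m, p', q', hp', hq', rfl⟩ := ihy
    exact ⟨n + m, p + p', q + q', hp.add hp', hq.add hq', by abel⟩
  | neg x _ ih =>
    obtain ⟨n, p, q, hp, hq, rfl⟩ := ih
    exact ⟨n, q, p, hq, hp, by abel⟩

theorem IsSubMV.closure_sup_mem (h : IsSubMV u S) {x y : ∀ i, C i}
    (hx : x ∈ AddSubgroup.closure S) (hy : y ∈ AddSubgroup.closure S) :
    x ⊔ y ∈ AddSubgroup.closure S := by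
  obtain ⟨n, p, q, hp, hq, rfl⟩ := exists_sumN_of_mem_closure h hx
  obtain ⟨m, p', q', hp', hq', rfl⟩ := exists_sumN_of_mem_closure h hy
  have e : (p - q) ⊔ (p' - q') = (p + q') ⊔ (q + p') - (q + q') := by
    have h1 : p - q = p + q' - (q + q') := by abel
    have h2 : p' - q' = q + p' - (q + q') := by abel
    rw [h1, h2]
    funext i
    simp only [Pi.sup_apply, Pi.sub_apply]
    exact (sup_sub _ _ _).symm
  rw [e]
  exact sub_mem (SumN.sup h (hp.add hq') (hq.add hp')).mem_closure
    (AddMemClass.add_mem hq.mem_closure hq'.mem_closure)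

theorem IsSubMV.closure_inf_mem (h : IsSubMV u S) {x y : ∀ i, C i}
    (hx : x ∈ AddSubgroup.closure S) (hy : y ∈ AddSubgroup.closure S) :
    x ⊓ y ∈ AddSubgroup.closure S := by
  have e : x ⊓ y = -(-x ⊔ -y) := by
    funext i
    simp only [Pi.inf_apply, Pi.neg_apply, Pi.sup_apply]
    rw [neg_sup, _root_.neg_neg, _root_.neg_neg]
  rw [e]
  exact neg_mem (h.closure_sup_mem (neg_mem hx) (neg_mem hy))

theorem IsSubMV.exists_abs_le (h : IsSubMV u S) {x : ∀ i, C i}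
    (hx : x ∈ AddSubgroup.closure S) : ∃ n : ℕ, x ⊔ -x ≤ n • u := by
  have hle : ∀ {n : ℕ} {x : ∀ i, C i}, SumN S n x → x ≤ n • u := by
    intro n
    induction n with
    | zero => intro x hx; rw [SumN] at hx; rw [hx, zero_nsmul]
    | succ n ih =>
      rintro x ⟨a, ha, y, hy, rfl⟩
      rw [succ_nsmul, add_comm]
      exact _root_.add_le_add (ih hy) (h.le_unit ha)
  obtain ⟨n, p, q, hp, hq, rfl⟩ := exists_sumN_of_mem_closure h hx
  refine ⟨n, sup_le ?_ ?_⟩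
  · exact (sub_le_self _ (SumN.nonneg h hq)).trans (hle hp)
  · rw [neg_sub]
    exact (sub_le_self _ (SumN.nonneg h hp)).trans (hle hq)

end Generation

section Star

variable (A : Type v) [MVAlgebra A]

theorem isSubMV_range : IsSubMV (starUnit A) (Set.range (iotaHat (A := A))) where
  zero_mem := ⟨0, rfl⟩
  nonneg := by rintro _ ⟨a, rfl⟩ P; exact Chang.iota_nonneg _
  le_unit := by rintro _ ⟨a, rfl⟩ P; exact Chang.iota_le_unit _
  add_mem := by
    rintro _ _ ⟨a, rfl⟩ ⟨b, rfl⟩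
    exact ⟨a + b, funext fun P => Chang.iota_add (P.toMVIdeal.cls a) (P.toMVIdeal.cls b)⟩
  compl_mem := by
    rintro _ ⟨a, rfl⟩
    exact ⟨aᶜ, funext fun P => Chang.iota_compl (P.toMVIdeal.cls a)⟩

/-- The underlying set of `A*`. -/
def MVStar : Type v := {σ : ChangProd A // σ ∈ starSubgroup A}

noncomputable instance : AddCommGroup (MVStar A) :=
  (starSubgroup A).toAddCommGroup

noncomputable instance : Lattice (MVStar A) :=
  Subtype.lattice (P := fun x => x ∈ starSubgroup A)
    (fun {_ _} hx hy => (isSubMV_range A).closure_sup_mem hx hy)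
    (fun {_ _} hx hy => (isSubMV_range A).closure_inf_mem hx hy)

instance : IsOrderedAddMonoid (MVStar A) where
  add_le_add_left _ _ h z := fun P => _root_.add_le_add_left (h P) (z.1 P)

end Star

/-! ## The categories and the functor `Γ` -/

/-- An `l_u`-group: an abelian lattice-ordered group with a strong unit. -/
structure LuGrp : Type (v + 1) where
  carrier : Type v
  [addCommGroup : AddCommGroup carrier]
  [lattice : Lattice carrier]
  [isOrderedAddMonoid : IsOrderedAddMonoid carrier]
  unit : carrier
  unit_nonneg : 0 ≤ unit
  exists_abs_le : ∀ x : carrier, ∃ n : ℕ, |x| ≤ n • unit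

/-- The (bundled) MV-algebras. -/
structure MVAlg : Type (v + 1) where
  carrier : Type v
  [mvAlgebra : MVAlgebra carrier]

instance : CoeSort LuGrp.{v} (Type v) := ⟨LuGrp.carrier⟩
instance : CoeSort MVAlg.{v} (Type v) := ⟨MVAlg.carrier⟩

attribute [instance] LuGrp.addCommGroup LuGrp.lattice LuGrp.isOrderedAddMonoid MVAlg.mvAlgebra

/-- Unital `l`-homomorphisms. -/
@[ext] structure LuHom (G H : LuGrp.{v}) where
  toFun : G → H
  map_add : ∀ x y, toFun (x + y) = toFun x + toFun y
  map_sup : ∀ x y, toFun (x ⊔ y) = toFun x ⊔ toFun y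
  map_inf : ∀ x y, toFun (x ⊓ y) = toFun x ⊓ toFun y
  map_unit : toFun G.unit = H.unit

instance : Category MVAlg.{v} where
  Hom A B := MVHom A B
  id A := ⟨fun a => a, rfl, fun _ _ => rfl, fun _ => rfl⟩
  comp f g := ⟨fun a => g.toFun (f.toFun a), by rw [f.map_zero, g.map_zero],
    fun a b => by rw [f.map_add, g.map_add], fun a => by rw [f.map_compl, g.map_compl]⟩

instance : Category LuGrp.{v} where
  Hom G H := LuHom G H
  id G := ⟨fun a => a, fun _ _ => rfl, fun _ _ => rfl, fun _ _ => rfl, rfl⟩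
  comp f g := ⟨fun a => g.toFun (f.toFun a), fun a b => by rw [f.map_add, g.map_add],
    fun a b => by rw [f.map_sup, g.map_sup], fun a b => by rw [f.map_inf, g.map_inf],
    by rw [f.map_unit, g.map_unit]⟩

/-- The underlying set of `Γ(G, u)`: the segment `[0, u]`. -/
def Seg (G : LuGrp.{v}) : Type v := {x : G // 0 ≤ x ∧ x ≤ G.unit}

namespace Seg

variable (G : LuGrp.{v})

instance : Zero (Seg G) := ⟨⟨0, le_rfl, G.unit_nonneg⟩⟩

/-- `x ⊕ y = u ∧ (x + y)`. -/
instance : Add (Seg G) :=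
  ⟨fun x y => ⟨G.unit ⊓ (x.1 + y.1),
    le_inf G.unit_nonneg (add_nonneg x.2.1 y.2.1), inf_le_left⟩⟩

/-- `¬ x = u - x`. -/
instance : Compl (Seg G) :=
  ⟨fun x => ⟨G.unit - x.1, sub_nonneg.2 x.2.2, sub_le_self _ x.2.1⟩⟩

variable {G}

theorem val_zero : (0 : Seg G).1 = 0 := rfl
theorem val_add (x y : Seg G) : (x + y).1 = G.unit ⊓ (x.1 + y.1) := rfl
theorem val_compl (x : Seg G) : xᶜ.1 = G.unit - x.1 := rfl

theorem add_comm' (x y : Seg G) : x + y = y + x :=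
  Subtype.ext (by rw [val_add, val_add, add_comm])

theorem zero_add' (x : Seg G) : 0 + x = x :=
  Subtype.ext (by rw [val_add, val_zero, zero_add]; exact inf_eq_right.2 x.2.2)

theorem val_add_add (x y z : Seg G) : (x + y + z).1 = G.unit ⊓ (x.1 + y.1 + z.1) := by
  have h : G.unit ≤ G.unit + z.1 := le_add_of_nonneg_right z.2.1
  rw [val_add, val_add, inf_add, ← inf_assoc, inf_eq_left.2 h]

theorem val_luk (x y : Seg G) : ((xᶜ + y)ᶜ + y).1 = x.1 ⊔ y.1 := by
  have h : G.unit - G.unit ⊓ (G.unit - x.1 + y.1) + y.1 = x.1 ⊔ y.1 := by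
    rw [sub_inf, sub_self, sup_add, zero_add]
    have : G.unit - (G.unit - x.1 + y.1) + y.1 = x.1 := by abel
    rw [this, sup_comm]
  rw [val_add, val_compl, val_add, val_compl, h]
  exact inf_eq_right.2 (sup_le x.2.2 y.2.2)

instance : MVAlgebra (Seg G) where
  nsmul := nsmulRec
  add_comm := add_comm'
  zero_add := zero_add'
  add_zero x := by rw [add_comm', zero_add']
  add_assoc x y z := by
    rw [add_comm' x (y + z)]
    apply Subtype.ext
    rw [val_add_add, val_add_add]
    congr 1; abel
  neg_neg x := Subtype.ext (by rw [val_compl, val_compl, sub_sub_cancel])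
  add_one x := Subtype.ext (by
    rw [val_add, val_compl, val_zero, sub_zero]
    exact inf_eq_left.2 (le_add_of_nonneg_left x.2.1))
  lukasiewicz x y := Subtype.ext (by rw [val_luk, val_luk, sup_comm])

end Seg

theorem LuHom.map_zero {G H : LuGrp.{v}} (f : LuHom G H) : f.toFun 0 = 0 := by
  have h := f.map_add 0 0
  rw [add_zero] at h
  exact left_eq_add.1 h

theorem LuHom.map_sub {G H : LuGrp.{v}} (f : LuHom G H) (x y : G) :
    f.toFun (x - y) = f.toFun x - f.toFun y := by
  rw [eq_sub_iff_add_eq, ← f.map_add, sub_add_cancel]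

theorem LuHom.mono {G H : LuGrp.{v}} (f : LuHom G H) {x y : G} (h : x ≤ y) :
    f.toFun x ≤ f.toFun y := by
  rw [← sup_eq_right, ← f.map_sup, sup_eq_right.2 h]

/-- `Γ` on arrows: the restriction `[0, u_G] → [0, u_H]`. -/
def LuHom.seg {G H : LuGrp.{v}} (f : LuHom G H) : MVHom (Seg G) (Seg H) where
  toFun x := ⟨f.toFun x.1, (LuHom.map_zero f).symm.trans_le (LuHom.mono f x.2.1),
    (LuHom.mono f x.2.2).trans_eq (LuHom.map_unit f)⟩
  map_zero := Subtype.ext (LuHom.map_zero f)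
  map_add x y := Subtype.ext ((f.map_inf _ _).trans (congrArg₂ _ f.map_unit (f.map_add _ _)))
  map_compl x := Subtype.ext ((f.map_sub _ _).trans (congrArg (· - f.toFun x.1) f.map_unit))

/-- The segment functor `Γ` from `l_u`-groups to MV-algebras. -/
def Gam : LuGrp.{v} ⥤ MVAlg.{v} where
  obj G := ⟨Seg G⟩
  map f := LuHom.seg f

/-- The `l_u`-group `A*`. -/
noncomputable def starObj (A : MVAlg.{v}) : LuGrp.{v} where
  carrier := MVStar A
  unit := ⟨starUnit A, AddSubgroup.subset_closure ⟨0ᶜ, rfl⟩⟩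
  unit_nonneg := (isSubMV_range A).nonneg ⟨0ᶜ, rfl⟩
  exists_abs_le := fun x => (isSubMV_range A).exists_abs_le x.2

/-- The inclusion `A* ⊂ ∏_P (A/P)*`. -/
def starIncl {A : MVAlg.{v}} (s : starObj A) : ChangProd A := Subtype.val s

/-- The inclusion `Γ(G, u) ⊂ G`. -/
def Seg.incl {G : LuGrp.{v}} (x : Seg G) : G := x.1

/-- `h* : ∏_{P ∈ Sp(A)} (A/P)* → ∏_{P ∈ Sp(B)} (B/P)*`,
`h*(σ)(P) = (h|_P)*(σ(h⁻¹P))`. -/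
noncomputable def prodMap {A B : MVAlg.{v}} (h : A ⟶ B) (σ : ChangProd A) : ChangProd B :=
  fun P => Chang.map (MVHom.quot h P) (σ (MVHom.comap h P))

/-! ## Prime `l`-ideals -/

/-- `Sp(G)`: the prime `l`-ideals of `G`, that is the proper convex `l`-subgroups `P` such
that `x⁺ ∈ P` or `x⁻ ∈ P` for all `x` (so that `G/P` is totally ordered). -/
structure LSpec (G : LuGrp.{v}) extends AddSubgroup G where
  mem_of_abs_le : ∀ {x y : G}, |x| ≤ |y| → y ∈ carrier → x ∈ carrier
  ne_univ : carrier ≠ Set.univ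
  prime : ∀ x : G, x ⊔ 0 ∈ carrier ∨ -x ⊔ 0 ∈ carrier

namespace LSpec

variable {G : LuGrp.{v}} (P : LSpec G)

theorem mem_of_le {x y : G} (hx : 0 ≤ x) (h : x ≤ y) (hy : y ∈ P.carrier) : x ∈ P.carrier :=
  P.mem_of_abs_le (by rwa [abs_of_nonneg hx, abs_of_nonneg (hx.trans h)]) hy

theorem val_ominus (x y : Seg G) : (ominus x y).1 = (x.1 - y.1) ⊔ 0 := by
  show G.unit - G.unit ⊓ (G.unit - x.1 + y.1) = _
  rw [sub_inf, sub_self, sup_comm]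
  congr 1
  abel

/-- The class `[x]_P` in `G/P`. -/
def cls (x : G) : G ⧸ P.toAddSubgroup := QuotientAddGroup.mk x

/-- `P ∩ [0, u] ∈ Sp(Γ(G, u))`. -/
def trace : MVSpec (Seg G) where
  carrier := {x | x.1 ∈ P.carrier}
  zero_mem := P.zero_mem
  add_mem {a b} ha hb :=
    P.mem_of_le (a + b).2.1 inf_le_right (P.toAddSubgroup.add_mem ha hb)
  mem_of_le {a b} hab hb := by
    refine P.mem_of_le a.2.1 ?_ hb
    have h := MVAlgebra.add_ominus_of_le hab
    rw [← h]
    exact le_inf a.2.2 (le_add_of_nonneg_right (ominus b a).2.1)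
  ne_univ h := by
    apply P.ne_univ
    apply Set.eq_univ_of_forall
    intro x
    obtain ⟨n, hn⟩ := G.exists_abs_le x
    have hu : G.unit ∈ P.carrier := by
      have : (⟨G.unit, G.unit_nonneg, le_rfl⟩ : Seg G) ∈ {x : Seg G | x.1 ∈ P.carrier} := by
        rw [h]; trivial
      exact this
    refine P.mem_of_abs_le (y := n • G.unit) ?_ (P.toAddSubgroup.nsmul_mem hu n)
    exact hn.trans (le_abs_self _)
  prime a b := by
    show (ominus a b).1 ∈ P.carrier ∨ (ominus b a).1 ∈ P.carrier
    rw [val_ominus, val_ominus, ← neg_sub a.1 b.1]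
    exact P.prime (a.1 - b.1)

end LSpec

/-! ## Prime ideals of preordered monoids -/

/-! Everything rests on two separation theorems: in an MV-algebra the prime ideals meet in `0`, and
in an `l_u`-group the prime `l`-ideals meet in `0`. Both come from one Zorn argument,
`IsMonoidIdeal.exists_prime`: an ideal maximal among those avoiding `g` contains one member of every
pair that is disjoint as seen from `g`. The pairs used are `x ⊖ y`, `y ⊖ x` in an MV-algebra and
`x⁺`, `x⁻` in a group.

Separation makes `a ↦ ı â` injective. Its image is a sub-MV-algebra `S` of `[0, u]`, and Riesz-type
subtraction shows that the positive elements of the group generated by `S` are exactly the finite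
sums from `S`. Truncating such a sum at `u` stays in `S`, so `S` is the whole segment of `A*`; this
gives `A ≅ Γ(A*, u)`.

In the other direction, Chang's maps on the fibers are additive. The family obtained from `s ∈ Γ(G,
u)*` is the family of classes of a single `g ∈ G`: this is clear for `s = ı x̂`, with `g = x`, and
is inherited by sums and negatives. Separation in `G` makes `g` unique, so `υ(s) = g` is a
well-defined morphism. It is onto because positive elements of `G` are sums of elements of `[0, u]`.
It is injective because it is the inclusion on the segment of `Γ(G, u)*`, which has just been
identified with `Γ(G, u)`, and a positive element of an `l_u`-group vanishes once its truncation at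
`u` does. It is not needed that every prime ideal of `Γ(G, u)` is a trace `P ∩ [0, u]`. -/

/-- A down-closed submonoid of a commutative monoid with a relation `le`. -/
structure IsMonoidIdeal {M : Type v} [AddCommMonoid M] (le : M → M → Prop) (I : Set M) : Prop where
  zero_mem : 0 ∈ I
  add_mem : ∀ {a b : M}, a ∈ I → b ∈ I → a + b ∈ I
  mem_of_le : ∀ {a b : M}, le a b → b ∈ I → a ∈ I

namespace IsMonoidIdeal

variable {M : Type v} [AddCommMonoid M] {le : M → M → Prop}

/-- This is the ideal generated by `I` and `p`, against which maximality is tested in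
`exists_prime`. -/
theorem adjoin (refl : ∀ a, le a a) (trans : ∀ {a b c}, le a b → le b c → le a c)
    (add : ∀ {a b c d}, le a b → le c d → le (a + c) (b + d)) {I : Set M}
    (h : IsMonoidIdeal le I) (p : M) :
    IsMonoidIdeal le {b | ∃ m ∈ I, ∃ n : ℕ, le b (m + n • p)} where
  zero_mem := ⟨0, h.zero_mem, 0, by rw [zero_nsmul, add_zero]; exact refl 0⟩
  add_mem := by
    rintro a b ⟨m, hm, n, ha⟩ ⟨m', hm', n', hb⟩
    refine ⟨m + m', h.add_mem hm hm', n + n', ?_⟩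
    rw [add_nsmul, add_add_add_comm]
    exact add ha hb
  mem_of_le := fun hab ⟨m, hm, n, hb⟩ => ⟨m, hm, n, trans hab hb⟩

/-- An element below both `c + i p` and `c + j q` is below `c`, if this holds for
`i = j = 1` and all `c`. -/
theorem le_of_le_add_nsmul (refl : ∀ a, le a a) (trans : ∀ {a b c}, le a b → le b c → le a c)
    (add : ∀ {a b c d}, le a b → le c d → le (a + c) (b + d)) (zero_le : ∀ a, le 0 a)
    {p q g c : M} (hpq : ∀ c, le g (c + p) → le g (c + q) → le g c) {k l : ℕ}
    (hp : le g (c + k • p)) (hq : le g (c + l • q)) : le g c := by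
  have le_add : ∀ a b, le a (a + b) := fun a b => by
    have := add (refl a) (zero_le b)
    rwa [add_zero] at this
  -- Descend through the grid `0 ≤ i ≤ k`, `0 ≤ j ≤ l`, with `d = k - i` and `e = l - j`. The edges
  -- `i = k` and `j = l` are the hypotheses; inside, `hpq` combines the neighbours `(i + 1, j)` and
  -- `(i, j + 1)`.
  have key : ∀ d i, i + d = k → ∀ e j, j + e = l → le g (c + i • p + j • q) := by
    intro d
    induction d with
    | zero => rintro i rfl e j -; exact trans hp (le_add _ _)
    | succ d ihd =>
      intro i hi e
      induction e with
      | zero =>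
        rintro j rfl
        rw [add_right_comm]
        exact trans hq (le_add _ _)
      | succ e ihe =>
        intro j hj
        refine hpq _ ?_ ?_
        · have := ihd (i + 1) (by omega) (e + 1) j hj
          rwa [succ_nsmul, ← add_assoc, add_right_comm] at this
        · have := ihe (j + 1) (by omega)
          rwa [succ_nsmul, ← add_assoc] at this
  have := key k 0 (zero_add k) l 0 (zero_add l)
  rwa [zero_nsmul, zero_nsmul, add_zero, add_zero] at this

/-- Separation of `g` from `0` by an ideal that is prime for all disjoint pairs `p`, `q`. -/
theorem exists_prime (refl : ∀ a, le a a) (trans : ∀ {a b c}, le a b → le b c → le a c)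
    (add : ∀ {a b c d}, le a b → le c d → le (a + c) (b + d)) (zero_le : ∀ a, le 0 a)
    {g : M} (hg : ¬ le g 0) :
    ∃ I, IsMonoidIdeal le I ∧ g ∉ I ∧
      ∀ p q, (∀ c, le g (c + p) → le g (c + q) → le g c) → p ∈ I ∨ q ∈ I := by
  have h0 : IsMonoidIdeal le {x | le x 0} :=
    { zero_mem := refl 0
      add_mem := fun {a b} ha hb => by
        have := add ha hb
        rwa [add_zero] at this
      mem_of_le := trans }
  obtain ⟨I, -, hI⟩ := zorn_subset_nonempty {I : Set M | IsMonoidIdeal le I ∧ g ∉ I}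
    (fun c hc hchain hne => by
      refine ⟨⋃₀ c, ⟨?_, ?_⟩, fun s hs => Set.subset_sUnion_of_mem hs⟩
      · refine ⟨?_, ?_, ?_⟩
        · obtain ⟨s, hs⟩ := hne
          exact ⟨s, hs, (hc hs).1.zero_mem⟩
        · rintro a b ⟨s, hs, ha⟩ ⟨t, ht, hb⟩
          rcases hchain.total hs ht with h | h
          · exact ⟨t, ht, (hc ht).1.add_mem (h ha) hb⟩
          · exact ⟨s, hs, (hc hs).1.add_mem ha (h hb)⟩
        · rintro a b hab ⟨s, hs, hb⟩
          exact ⟨s, hs, (hc hs).1.mem_of_le hab hb⟩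
      · rintro ⟨s, hs, h⟩
        exact (hc hs).2 h) _ ⟨h0, hg⟩
  -- By maximality, adjoining an element outside `I` must capture `g`.
  have adj : ∀ p, p ∉ I → ∃ m ∈ I, ∃ n : ℕ, le g (m + n • p) := by
    intro p hp
    by_contra hg'
    have hsub : I ⊆ {b | ∃ m ∈ I, ∃ n : ℕ, le b (m + n • p)} := fun b hb =>
      ⟨b, hb, 0, by rw [zero_nsmul, add_zero]; exact refl b⟩
    refine hp (hI.2 ⟨hI.1.1.adjoin refl trans add p, hg'⟩ hsub ?_)
    refine ⟨0, hI.1.1.zero_mem, 1, ?_⟩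
    rw [one_nsmul, zero_add]
    exact refl p
  refine ⟨I, hI.1.1, hI.1.2, fun p q hpq => ?_⟩
  by_contra! h
  obtain ⟨m, hm, k, hk⟩ := adj p h.1
  obtain ⟨m', hm', l, hl⟩ := adj q h.2
  -- Taking `c = m + m'` gives both bounds on `g` the same base in `I`.
  refine hI.1.2 (hI.1.1.mem_of_le (le_of_le_add_nsmul refl trans add zero_le hpq
    (c := m + m') (k := k) (l := l) ?_ ?_) (hI.1.1.add_mem hm hm'))
  · have := add hk (zero_le m')
    rwa [add_zero, add_right_comm] at this
  · have := add hl (zero_le m)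
    rwa [add_zero, add_right_comm, add_comm m'] at this

end IsMonoidIdeal

/-! ## Subdirect representations -/

namespace MVAlgebra

variable {A : Type v} [MVAlgebra A]

/-- `b ⊕ (a ⊖ b)` is the join of `a` and `b`. For leastness, write `c = b ⊕ (c ⊖ b)` and compare `a
⊖ b` with `c ⊖ b`. -/
theorem add_ominus_le {a b c : A} (ha : le a c) (hb : le b c) : le (b + ominus a b) c := by
  rw [← add_ominus_of_le hb]
  refine add_le_add (le_refl b) (ominus_le_iff.2 ?_)
  rwa [add_ominus_of_le hb]

theorem add_ominus_comm (a b : A) : b + ominus a b = a + ominus b a := by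
  unfold ominus
  rw [add_comm b, add_comm a, lukasiewicz]

theorem ominus_le_ominus {a b : A} (h : le a b) (c : A) : le (ominus a c) (ominus b c) :=
  ominus_le_iff.2 (le_trans h (ominus_le_iff.1 (le_refl _)))

/-- When `e ≤ ¬a` the sum `a ⊕ e` is not truncated, so subtracting `e` recovers `a`. -/
theorem le_add_ominus_of_le_compl {a e : A} (h : le e aᶜ) : le a (ominus (a + e) e) := by
  have h1 := compl_eq (odot_eq_zero.2 h)
  have h2 : odot a e = 0 := by rw [odot_comm]; exact odot_eq_zero.2 h
  have h3 := compl_eq h2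
  have h4 := compl_inj (show aᶜ = (ominus (a + e) e)ᶜ by
    unfold ominus; rw [h3, neg_neg, add_comm])
  rw [← h4]
  exact le_refl a

/-- `(x ⊖ y) ∧ (y ⊖ x) = 0`. -/
theorem eq_zero_of_le_ominus {x y e : A} (hx : le e (ominus x y)) (hy : le e (ominus y x)) :
    e = 0 := by
  -- Let `s = x ⊕ (y ⊖ x)` be the join of `x` and `y`. As `e ≤ y ⊖ x ≤ ¬x`, cancellation gives `x =
  -- (x ⊕ e) ⊖ e ≤ s ⊖ e`. By symmetry `y ≤ s ⊖ e`, so `s ⊖ e = s`.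
  have aux : ∀ x y : A, le e (ominus y x) → le x (ominus (x + ominus y x) e) := by
    intro x y h
    have h1 : le e xᶜ := le_trans h (compl_le (by rw [add_comm]; exact le_add _ _))
    exact le_trans (le_add_ominus_of_le_compl h1)
      (ominus_le_ominus (add_le_add (le_refl x) h) e)
  have h1 := aux x y hy
  have h2 := aux y x hx
  rw [add_ominus_comm] at h2
  have h3 := add_ominus_le h2 h1
  have h4 : le e (x + ominus y x) := le_trans hy (by rw [add_comm]; exact le_add _ _)
  have h5 : ominus (x + ominus y x) e = x + ominus y x :=
    le_antisymm (ominus_le_iff.2 (add_comm _ e ▸ le_add _ _)) h3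
  generalize x + ominus y x = s at h4 h5
  -- Since `e ≤ s`, `¬e = ¬s ⊕ (s ⊖ e) = ¬s ⊕ s = 1`.
  have h6 : odot e sᶜ = 0 := odot_eq_zero.2 (by rwa [neg_neg])
  have h7 := compl_eq h6
  unfold ominus at h5
  rw [add_comm e, h5, add_comm, add_compl] at h7
  exact compl_inj h7

/-- If `g` lies below `c ⊕ (a ⊖ b)` and `c ⊕ (b ⊖ a)`, then `g ⊖ c` lies below both differences and
is `0`. Hence the Zorn ideal is prime. -/
theorem exists_spec_notMem {g : A} (hg : g ≠ 0) : ∃ P : MVSpec A, g ∉ P.carrier := by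
  obtain ⟨I, hI, hgI, hp⟩ := IsMonoidIdeal.exists_prime (le := le) le_refl le_trans add_le_add
    zero_le (g := g) (fun h => hg (eq_zero_of_le h rfl))
  refine ⟨⟨⟨I, hI.zero_mem, hI.add_mem, hI.mem_of_le⟩, fun h => hgI (h.symm.subset trivial), ?_⟩, hgI⟩
  intro a b
  refine hp _ _ fun c h1 h2 => ?_
  have h3 := eq_zero_of_le_ominus (ominus_le_iff.2 h1) (ominus_le_iff.2 h2)
  have h4 : le (ominus g c) 0 := h3 ▸ le_refl _
  rwa [ominus_le_iff, add_zero] at h4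

end MVAlgebra

theorem Chang.iota_injective {C : Type v} [MVAlgebra C] [MVChain C] :
    Function.Injective (Chang.iota : C → Chang C) := by
  intro a b h
  unfold Chang.iota at h
  by_cases ha : a = 0ᶜ <;> by_cases hb : b = 0ᶜ
  · rw [ha, hb]
  · rw [ha, Chang.pair_one, Chang.pair_of_ne _ MVChain.zero_ne_one, Chang.pair_of_ne _ hb] at h
    exact absurd (congrArg Chang.lvl h) (by simp)
  · rw [hb, Chang.pair_one, Chang.pair_of_ne _ MVChain.zero_ne_one, Chang.pair_of_ne _ ha] at h
    exact absurd (congrArg Chang.lvl h) (by simp)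
  · rw [Chang.pair_of_ne _ ha, Chang.pair_of_ne _ hb] at h
    exact congrArg Chang.val h

/-- Equal images put `a ⊖ b` and `b ⊖ a` in every prime ideal, so both vanish. -/
theorem iotaHat_injective {A : Type v} [MVAlgebra A] :
    Function.Injective (iotaHat : A → ChangProd A) := by
  have key : ∀ a b : A, iotaHat a = iotaHat b → MVAlgebra.le a b := by
    intro a b h
    have h0 : ominus a b = 0 := by
      by_contra hne
      obtain ⟨P, hP⟩ := MVAlgebra.exists_spec_notMem hne
      exact hP (P.toMVIdeal.cls_eq_cls.1 (Chang.iota_injective (congrFun h P))).1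
    have h1 : MVAlgebra.le (ominus a b) 0 := h0 ▸ MVAlgebra.le_refl _
    rwa [ominus_le_iff, add_zero] at h1
  exact fun a b h => MVAlgebra.le_antisymm (key a b h) (key b a h.symm)

/-! ### Separation by prime `l`-ideals -/

namespace LSpec

variable {G : LuGrp.{v}}

/-- The Zorn argument is run in the positive cone, for `|g|`, and the resulting ideal is pulled back
along `x ↦ |x|`. Primality comes from `x⁺ ⊓ x⁻ = 0`. -/
theorem exists_notMem {g : G} (hg : g ≠ 0) : ∃ P : LSpec G, g ∉ P.carrier := by
  obtain ⟨I, hI, hgI, hp⟩ := IsMonoidIdeal.exists_prime (M := {x : G // 0 ≤ x})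
    (le := fun x y => x ≤ y) _root_.le_refl _root_.le_trans _root_.add_le_add (fun a => a.2)
    (g := ⟨|g|, abs_nonneg g⟩)
    (fun h => hg (_root_.le_antisymm ((le_abs_self g).trans h) (neg_nonpos.1 ((neg_le_abs g).trans h))))
  refine ⟨⟨⟨⟨⟨{x : G | (⟨|x|, abs_nonneg x⟩ : {x : G // 0 ≤ x}) ∈ I}, ?_⟩, ?_⟩, ?_⟩, ?_, ?_, ?_⟩,
    hgI⟩
  · intro a b ha hb
    exact hI.mem_of_le (show (⟨|a + b|, _⟩ : {x : G // 0 ≤ x}) ≤ _ from abs_add_le a b)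
      (hI.add_mem ha hb)
  · exact hI.mem_of_le (show (⟨|0|, _⟩ : {x : G // 0 ≤ x}) ≤ 0 from abs_zero.le) hI.zero_mem
  · intro a ha
    simpa using ha
  · intro x y hxy hy
    exact hI.mem_of_le (show (⟨|x|, _⟩ : {x : G // 0 ≤ x}) ≤ _ from hxy) hy
  · intro h
    exact hgI (show g ∈ {x : G | (⟨|x|, abs_nonneg x⟩ : {x : G // 0 ≤ x}) ∈ I} from
      h.symm.subset trivial)
  · intro x
    have hx := hp ⟨x ⊔ 0, le_sup_right⟩ ⟨-x ⊔ 0, le_sup_right⟩ (fun c h1 h2 => by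
      have h1' : |g| - c.1 ≤ x ⊔ 0 := sub_le_iff_le_add'.2 h1
      have h2' : |g| - c.1 ≤ -x ⊔ 0 := sub_le_iff_le_add'.2 h2
      have h3 : (x ⊔ 0) ⊓ (-x ⊔ 0) = 0 := posPart_inf_negPart_eq_zero x
      exact (sub_nonpos (a := |g|) (b := c.1)).1 ((le_inf h1' h2').trans_eq h3))
    refine hx.imp (fun h => ?_) (fun h => ?_)
    · have e : (⟨|x ⊔ 0|, abs_nonneg _⟩ : {x : G // 0 ≤ x}) = ⟨x ⊔ 0, le_sup_right⟩ :=
        Subtype.ext (abs_of_nonneg le_sup_right)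
      show (⟨|x ⊔ 0|, abs_nonneg _⟩ : {x : G // 0 ≤ x}) ∈ I
      rw [e]
      exact h
    · have e : (⟨|-x ⊔ 0|, abs_nonneg _⟩ : {x : G // 0 ≤ x}) = ⟨-x ⊔ 0, le_sup_right⟩ :=
        Subtype.ext (abs_of_nonneg le_sup_right)
      show (⟨|-x ⊔ 0|, abs_nonneg _⟩ : {x : G // 0 ≤ x}) ∈ I
      rw [e]
      exact h

theorem cls_eq_cls (P : LSpec G) {x y : G} : P.cls x = P.cls y ↔ x - y ∈ P.carrier := by
  unfold cls
  rw [QuotientAddGroup.eq_iff_sub_mem]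
  rfl

/-- This allows identities in `G` to be checked modulo each prime. -/
theorem eq_of_forall_cls {x y : G} (h : ∀ P : LSpec G, P.cls x = P.cls y) : x = y := by
  by_contra hne
  obtain ⟨P, hP⟩ := exists_notMem (sub_ne_zero.2 hne)
  exact hP (P.cls_eq_cls.1 (h P))

end LSpec

/-! ## Positive elements of the generated group -/

section Generation

variable {ι : Type v} {C : ι → Type w} [∀ i, AddCommGroup (C i)] [∀ i, LinearOrder (C i)]
  [∀ i, IsOrderedAddMonoid (C i)] {u : ∀ i, C i} {S : Set (∀ i, C i)}

theorem SumN.sub_mem_sup (h : IsSubMV u S) :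
    ∀ {n : ℕ} {x a : ∀ i, C i}, SumN S n x → a ∈ S → SumN S n ((x - a) ⊔ 0)
  | 0, x, a, hx, ha => by
    rw [SumN] at hx ⊢
    rw [hx, zero_sub]
    exact sup_eq_right.2 (neg_nonpos.2 (h.nonneg ha))
  | n + 1, _, a, hx, ha => by
    obtain ⟨b, hb, y, hy, rfl⟩ := hx
    -- Subtract `a` from the first summand `b` and carry the excess `(a - b)⁺` over to `y`. Both
    -- positive parts are written as `⊙`-products so that `odot_mem` applies.
    have e : (b + y - a) ⊔ 0 = (b + (u - a) - u) ⊔ 0 + (y - (a + (u - b) - u) ⊔ 0) ⊔ 0 := by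
      funext i
      have h1 := SumN.nonneg h hy i
      simp only [Pi.sup_apply, Pi.sub_apply, Pi.add_apply, Pi.zero_apply] at h1 ⊢
      have e1 : b i + (u i - a i) - u i = b i - a i := by abel
      have e2 : a i + (u i - b i) - u i = a i - b i := by abel
      rw [e1, e2]
      rcases le_total (a i) (b i) with k | k
      · have e3 : b i + y i - a i = b i - a i + y i := by abel
        rw [sup_eq_left.2 (sub_nonneg.2 k), sup_eq_right.2 (sub_nonpos.2 k), sub_zero,
          sup_eq_left.2 h1, e3, sup_eq_left.2 (add_nonneg (sub_nonneg.2 k) h1)]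
      · have e3 : b i + y i - a i = y i - (a i - b i) := by abel
        rw [sup_eq_right.2 (sub_nonpos.2 k), sup_eq_left.2 (sub_nonneg.2 k), zero_add, e3]
    rw [e]
    exact ⟨_, h.odot_mem hb (h.compl_mem ha), _,
      SumN.sub_mem_sup h hy (h.odot_mem ha (h.compl_mem hb)), rfl⟩

/-- The summands of `y` are removed one at a time, truncating at `0` after each; this is harmless
since the rest of `y` is nonnegative. -/
theorem SumN.sub_sumN_sup (h : IsSubMV u S) {n : ℕ} :
    ∀ {m : ℕ} {x y : ∀ i, C i}, SumN S n x → SumN S m y → SumN S n ((x - y) ⊔ 0)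
  | 0, x, y, hx, hy => by
    rw [SumN] at hy
    rw [hy, sub_zero, sup_eq_left.2 (SumN.nonneg h hx)]
    exact hx
  | m + 1, x, _, hx, hy => by
    obtain ⟨a, ha, y, hy, rfl⟩ := hy
    have e : (x - (a + y)) ⊔ 0 = ((x - a) ⊔ 0 - y) ⊔ 0 := by
      funext i
      have h1 := sub_nonpos.2 (SumN.nonneg h hy i)
      simp only [Pi.sup_apply, Pi.sub_apply, Pi.add_apply, Pi.zero_apply] at h1 ⊢
      rw [sup_sub, sup_assoc, sup_eq_right.2 h1, sub_sub]
    rw [e]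
    exact SumN.sub_sumN_sup h (SumN.sub_mem_sup h hx ha) hy

/-- A nonnegative difference `p - q` of sums equals `(p - q)⁺`, which is again a sum. -/
theorem IsSubMV.exists_sumN_of_nonneg (h : IsSubMV u S) {x : ∀ i, C i}
    (hx : x ∈ AddSubgroup.closure S) (h0 : 0 ≤ x) : ∃ n, SumN S n x := by
  obtain ⟨n, p, q, hp, hq, rfl⟩ := exists_sumN_of_mem_closure h hx
  refine ⟨n, ?_⟩
  rw [← sup_eq_left.2 h0]
  exact SumN.sub_sumN_sup h hp hq

/-- Such an `x` is a sum from `S` that equals its own truncation at `u`. This yields surjectivity of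
`A → Γ(A*, u)`. -/
theorem IsSubMV.mem_of_mem_closure (h : IsSubMV u S) {x : ∀ i, C i}
    (hx : x ∈ AddSubgroup.closure S) (h0 : 0 ≤ x) (hu : x ≤ u) : x ∈ S := by
  obtain ⟨n, hn⟩ := h.exists_sumN_of_nonneg hx h0
  have := SumN.inf_mem h hn
  rwa [inf_eq_left.2 hu] at this

end Generation

/-! ## The functor `A ↦ A*` -/

namespace Chang

variable {A : Type v} {B : Type w} [MVAlgebra A] [MVChain A] [MVAlgebra B] [MVChain B]

/-- Pass through `(m, 1) = (m + 1, 0)`. The inequality is weak because `a = 1`, `b = 0`, `n = m + 1`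
is allowed. -/
theorem pair_le_pair_of_lt {m n : ℤ} (h : m < n) (a b : A) : pair m a ≤ pair n b := by
  refine (pair_le_pair m (le_one a)).trans (le_trans ?_ (pair_le_pair n (MVAlgebra.zero_le b)))
  rw [pair_one, pair_of_ne _ MVChain.zero_ne_one, pair_of_ne _ MVChain.zero_ne_one, le_def]
  rcases (Int.add_one_le_of_lt h).lt_or_eq with k | k
  · exact Or.inl k
  · exact Or.inr ⟨k, MVAlgebra.le_refl _⟩

/-- Between chains, monotonicity already gives preservation of `⊔` and `⊓`. -/
theorem map_mono (f : MVHom A B) : Monotone (map f) := by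
  rintro x y (h | ⟨h, h'⟩)
  · exact pair_le_pair_of_lt h _ _
  · unfold map
    rw [h]
    exact pair_le_pair _ (f.map_le h')

/-- `f*` respects the identification `(m, 1) = (m + 1, 0)`, so it may be computed on any
representative. -/
theorem map_pair (f : MVHom A B) (m : ℤ) (a : A) : map f (pair m a) = pair m (f.toFun a) := by
  by_cases ha : a = 0ᶜ
  · rw [ha, pair_one, f.map_compl, f.map_zero, pair_one, pair_of_ne _ MVChain.zero_ne_one]
    show pair (m + 1) (f.toFun 0) = _
    rw [f.map_zero]
  · rw [pair_of_ne _ ha]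
    rfl

theorem map_add (f : MVHom A B) (x y : Chang A) : map f (x + y) = map f x + map f y := by
  by_cases h : x.val + y.val = 0ᶜ
  · have h' : f.toFun x.val + f.toFun y.val = 0ᶜ := by
      rw [← f.map_add, h, f.map_compl, f.map_zero]
    have e : f.toFun (odot x.val y.val) = odot (f.toFun x.val) (f.toFun y.val) := by
      unfold odot
      rw [f.map_compl, f.map_add, f.map_compl, f.map_compl]
    rw [← pair_eta x, ← pair_eta y, pair_add_pair_of_eq _ _ h, map_pair, map_pair, map_pair,
      pair_add_pair_of_eq _ _ h', e]
  · rw [← pair_eta x, ← pair_eta y, pair_add_pair_of_ne _ _ h, map_pair, map_pair, map_pair,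
      f.map_add]
    -- A sum below `1` may be sent to `1` by `f`. Then the `⊙`-product is `0`, and the two values
    -- agree by `(m, 1) = (m + 1, 0)`.
    by_cases h' : f.toFun x.val + f.toFun y.val = 0ᶜ
    · have e : odot (f.toFun x.val) (f.toFun y.val) = 0 := by
        rw [← f.map_zero, ← odot_eq_zero_of_ne h]
        unfold odot
        rw [f.map_compl, f.map_add, f.map_compl, f.map_compl]
      rw [pair_add_pair_of_eq _ _ h', e, h', pair_one]
    · rw [pair_add_pair_of_ne _ _ h']

theorem map_iota (f : MVHom A B) (a : A) : map f (iota a) = iota (f.toFun a) := map_pair f 0 a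

end Chang

section ProdMap

variable {A B : MVAlg.{v}} (h : A ⟶ B)

theorem prodMap_add (σ τ : ChangProd A) : prodMap h (σ + τ) = prodMap h σ + prodMap h τ :=
  funext fun P => Chang.map_add (MVHom.quot h P) _ _

theorem prodMap_sup (σ τ : ChangProd A) : prodMap h (σ ⊔ τ) = prodMap h σ ⊔ prodMap h τ :=
  funext fun P => (Chang.map_mono (MVHom.quot h P)).map_sup _ _

theorem prodMap_inf (σ τ : ChangProd A) : prodMap h (σ ⊓ τ) = prodMap h σ ⊓ prodMap h τ :=
  funext fun P => (Chang.map_mono (MVHom.quot h P)).map_inf _ _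

theorem prodMap_iotaHat (a : A) : prodMap h (iotaHat a) = iotaHat (MVHom.toFun h a) :=
  funext fun P => Chang.map_iota (MVHom.quot h P) _

theorem prodMap_mem {σ : ChangProd A} (hσ : σ ∈ starSubgroup A) :
    prodMap h σ ∈ starSubgroup B := by
  let F : ChangProd A →+ ChangProd B := AddMonoidHom.mk' (prodMap h) (prodMap_add h)
  have : starSubgroup A ≤ (starSubgroup B).comap F := by
    refine (AddSubgroup.closure_le _).2 ?_
    rintro _ ⟨a, rfl⟩
    exact AddSubgroup.subset_closure ⟨MVHom.toFun h a, (prodMap_iotaHat h a).symm⟩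
  exact this hσ

/-- `h* : A* → B*`. -/
noncomputable def starMap : starObj A ⟶ starObj B where
  toFun s := ⟨prodMap h s.1, prodMap_mem h s.2⟩
  map_add s t := Subtype.ext (prodMap_add h s.1 t.1)
  map_sup s t := Subtype.ext (prodMap_sup h s.1 t.1)
  map_inf s t := Subtype.ext (prodMap_inf h s.1 t.1)
  map_unit := Subtype.ext ((prodMap_iotaHat h 0ᶜ).trans (congrArg iotaHat
    ((MVHom.map_compl h 0).trans (congrArg _ (MVHom.map_zero h)))))

end ProdMap

/-- `ı â` as an element of `A*`. -/
noncomputable def starGen {A : MVAlg.{v}} (a : A) : starObj A :=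
  ⟨iotaHat a, AddSubgroup.subset_closure ⟨a, rfl⟩⟩

theorem starIncl_injective {A : MVAlg.{v}} :
    Function.Injective (starIncl : starObj A → ChangProd A) := Subtype.val_injective

theorem star_induction {A : MVAlg.{v}} {p : starObj A → Prop} (gen : ∀ a, p (starGen a))
    (zero : p 0) (add : ∀ s t, p s → p t → p (s + t)) (neg : ∀ s, p s → p (-s))
    (s : starObj A) : p s := by
  obtain ⟨σ, hσ⟩ := s
  induction hσ using AddSubgroup.closure_induction with
  | mem σ h => obtain ⟨a, rfl⟩ := h; exact gen a
  | zero => exact zero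
  | add x y hx hy ihx ihy => exact add _ _ ihx ihy
  | neg x hx ih => exact neg _ ih

theorem LuHom.map_neg {G H : LuGrp.{v}} (f : LuHom G H) (x : G) : f.toFun (-x) = -f.toFun x := by
  rw [← zero_sub, f.map_sub, f.map_zero, zero_sub]

/-- Functoriality of `A*` and naturality of the counit are thereby reduced to the generators `ı â`.
-/
theorem star_hom_ext {A : MVAlg.{v}} {G : LuGrp.{v}} {f g : starObj A ⟶ G}
    (h : ∀ a, LuHom.toFun f (starGen a) = LuHom.toFun g (starGen a)) : f = g := by
  refine LuHom.ext (funext (star_induction h ?_ ?_ ?_))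
  · rw [LuHom.map_zero, LuHom.map_zero]
  · intro s t hs ht
    rw [LuHom.map_add, LuHom.map_add, hs, ht]
  · intro s hs
    rw [LuHom.map_neg, LuHom.map_neg, hs]

theorem starMap_starGen {A B : MVAlg.{v}} (h : A ⟶ B) (a : A) :
    LuHom.toFun (starMap h) (starGen a) = starGen (MVHom.toFun h a) :=
  Subtype.ext (prodMap_iotaHat h a)

/-- The functor `A ↦ A*`. -/
noncomputable def starFunctor : MVAlg.{v} ⥤ LuGrp.{v} where
  obj := starObj
  map := starMap
  map_id A := star_hom_ext fun a => starMap_starGen (𝟙 A) a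
  map_comp f g := star_hom_ext fun a => (starMap_starGen (f ≫ g) a).trans
    ((starMap_starGen g _).symm.trans
      (congrArg (LuHom.toFun (starMap g)) (starMap_starGen f a).symm))

/-! ## The isomorphism `A ≅ Γ(A*, u)` -/

/-- A bijective morphism of MV-algebras is an isomorphism. -/
noncomputable def MVAlg.isoOfBijective {A B : MVAlg.{v}} (f : A ⟶ B)
    (hf : Function.Bijective (MVHom.toFun f)) : A ≅ B :=
  let e := Equiv.ofBijective _ hf
  have he : ∀ x, MVHom.toFun f (e.symm x) = x := e.apply_symm_apply
  { hom := f
    inv :=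
      { toFun := e.symm
        map_zero := hf.1 ((he _).trans (MVHom.map_zero f).symm)
        map_add := fun x y => hf.1 (by rw [MVHom.map_add, he, he, he])
        map_compl := fun x => hf.1 (by rw [MVHom.map_compl, he, he]) }
    hom_inv_id := MVHom.ext (funext e.symm_apply_apply)
    inv_hom_id := MVHom.ext (funext he) }

theorem iotaHat_add {A : Type v} [MVAlgebra A] (a b : A) :
    iotaHat (a + b) = starUnit A ⊓ (iotaHat a + iotaHat b) :=
  funext fun P => (Chang.iota_add (P.toMVIdeal.cls a) (P.toMVIdeal.cls b)).trans (inf_comm _ _)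

/-- `a ↦ ı â` as a morphism `A → Γ(A*, u)`. -/
noncomputable def starUnitHom (A : MVAlg.{v}) : A ⟶ Gam.obj (starObj A) where
  toFun a := ⟨starGen a, (isSubMV_range A).nonneg ⟨a, rfl⟩, (isSubMV_range A).le_unit ⟨a, rfl⟩⟩
  map_zero := Subtype.ext (Subtype.ext rfl)
  map_add a b := Subtype.ext (Subtype.ext (iotaHat_add a b))
  map_compl a := Subtype.ext (Subtype.ext (funext fun P =>
    Chang.iota_compl (P.toMVIdeal.cls a)))

/-- Injectivity is the subdirect representation; surjectivity says that the generators fill the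
segment of `A*`. -/
theorem starUnitHom_bijective (A : MVAlg.{v}) :
    Function.Bijective (MVHom.toFun (starUnitHom A)) := by
  constructor
  · intro a b h
    exact iotaHat_injective (congrArg (fun x => starIncl (Seg.incl x)) h)
  · rintro ⟨⟨σ, hσ⟩, h0, h1⟩
    obtain ⟨a, ha⟩ := (isSubMV_range A).mem_of_mem_closure hσ h0 h1
    exact ⟨a, Subtype.ext (Subtype.ext ha)⟩

/-- The natural isomorphism `A ≅ Γ(A*, u)`. -/
noncomputable def starUnitIso : 𝟭 MVAlg.{v} ≅ starFunctor ⋙ Gam.{v} :=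
  NatIso.ofComponents (fun A => MVAlg.isoOfBijective (starUnitHom A) (starUnitHom_bijective A))
    (fun f => MVHom.ext (funext fun a => Subtype.ext (starMap_starGen f a).symm))

/-! ## The isomorphism `Γ(G, u)* ≅ (G, u)` -/

namespace LSpec

variable {G : LuGrp.{v}} (P : LSpec G)

theorem cls_add (x y : G) : P.cls (x + y) = P.cls x + P.cls y := rfl

/-- `G ⧸ P` is used only as a group, so joins are taken on representatives. Convexity of `P` applies
through `|x ⊔ z - y ⊔ z| ≤ |x - y|`. -/
theorem cls_sup {x y z : G} (h : P.cls x = P.cls y) : P.cls (x ⊔ z) = P.cls (y ⊔ z) :=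
  P.cls_eq_cls.2 (P.mem_of_abs_le (abs_sup_sub_sup_le_abs x y z) (P.cls_eq_cls.1 h))

/-- The map `Γ(G, u)/(P ∩ [0, u]) → G/P`. -/
def quotVal : P.trace.toMVIdeal.Quot → G ⧸ P.toAddSubgroup :=
  Quotient.lift (s := P.trace.toMVIdeal.setoid) (fun a => P.cls a.1) (fun a b h => by
    have h1 : (ominus a b).1 ∈ P.toAddSubgroup := h.1
    have h2 : (ominus b a).1 ∈ P.toAddSubgroup := h.2
    rw [val_ominus] at h1 h2
    have h3 : (a.1 - b.1) ⊔ 0 - (b.1 - a.1) ⊔ 0 = a.1 - b.1 := by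
      rw [← neg_sub a.1 b.1]
      exact posPart_sub_negPart (a.1 - b.1)
    exact P.cls_eq_cls.2 (h3 ▸ P.toAddSubgroup.sub_mem h1 h2))

theorem quotVal_zero : P.quotVal 0 = 0 := rfl

theorem quotVal_one : P.quotVal 0ᶜ = P.cls G.unit :=
  congrArg P.cls (sub_zero G.unit)

theorem val_odot (x y : Seg G) : (odot x y).1 = (x.1 + y.1 - G.unit) ⊔ 0 := by
  have h := val_ominus x yᶜ
  unfold ominus at h
  unfold odot
  rw [h, Seg.val_compl, sub_sub_eq_add_sub]

/-- Already in `G`, `(a ⊕ b) + (a ⊙ b) = a + b`. This covers both cases of Chang's addition: `a ⊕ b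
= 1` contributes `u`, and otherwise `a ⊙ b = 0`. -/
theorem quotVal_add_add_odot (x y : P.trace.toMVIdeal.Quot) :
    P.quotVal (x + y) + P.quotVal (odot x y) = P.quotVal x + P.quotVal y := by
  obtain ⟨a⟩ := x
  obtain ⟨b⟩ := y
  have h : (a + b).1 + (odot a b).1 = a.1 + b.1 := by
    have h1 := inf_add_sup (a.1 + b.1) G.unit
    have h2 : (a.1 + b.1 - G.unit) ⊔ 0 = (a.1 + b.1) ⊔ G.unit - G.unit := by
      rw [sup_sub, sub_self]
    rw [val_odot, Seg.val_add, h2, inf_comm, ← add_sub_assoc, h1, add_sub_cancel_right]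
  exact congrArg P.cls h

/-- Chang's map `(m, a) ↦ m u + a`. -/
noncomputable def chang (c : Chang P.trace.toMVIdeal.Quot) : G ⧸ P.toAddSubgroup :=
  c.lvl • P.cls G.unit + P.quotVal c.val

theorem chang_pair (m : ℤ) (a : P.trace.toMVIdeal.Quot) :
    P.chang (Chang.pair m a) = m • P.cls G.unit + P.quotVal a := by
  by_cases ha : a = 0ᶜ
  · rw [ha, Chang.pair_one, Chang.pair_of_ne _ MVChain.zero_ne_one, quotVal_one]
    show (m + 1) • P.cls G.unit + P.quotVal 0 = _
    rw [quotVal_zero, add_zero, add_zsmul, one_zsmul]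
  · rw [Chang.pair_of_ne _ ha]
    rfl

theorem chang_add (x y : Chang P.trace.toMVIdeal.Quot) :
    P.chang (x + y) = P.chang x + P.chang y := by
  have h := P.quotVal_add_add_odot x.val y.val
  have e : P.chang x + P.chang y =
      (x.lvl + y.lvl) • P.cls G.unit + (P.quotVal x.val + P.quotVal y.val) := by
    unfold chang
    rw [add_zsmul]
    abel
  by_cases hxy : x.val + y.val = 0ᶜ
  · rw [e, ← h, hxy, quotVal_one, Chang.add_of_eq _ _ hxy]
    unfold chang
    rw [add_zsmul (P.cls G.unit) (x.lvl + y.lvl), one_zsmul, add_assoc]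
  · rw [e, ← h, Chang.odot_eq_zero_of_ne hxy, quotVal_zero, add_zero, Chang.add_of_ne _ _ hxy]
    rfl

theorem chang_iota (a : P.trace.toMVIdeal.Quot) : P.chang (Chang.iota a) = P.quotVal a := by
  unfold Chang.iota
  rw [chang_pair, zero_zsmul, zero_add]

/-- Positivity of Chang's map, phrased with representatives in `G`: a nonnegative level `m` makes `m
u + a` nonnegative. -/
theorem exists_chang_eq_of_nonneg {c : Chang P.trace.toMVIdeal.Quot} (hc : 0 ≤ c) :
    ∃ g : G, 0 ≤ g ∧ P.chang c = P.cls g := by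
  obtain ⟨m, ⟨a⟩, hne⟩ := c
  have hm : 0 ≤ m := by
    rw [Chang.zero_def, Chang.le_def] at hc
    rcases hc with h | ⟨h, -⟩
    · exact _root_.le_of_lt h
    · exact _root_.le_of_eq h
  refine ⟨m • G.unit + a.1, add_nonneg (zsmul_nonneg G.unit_nonneg hm) a.2.1, rfl⟩

end LSpec

/-! ### The morphism `υ` and its bijectivity -/

section Counit

variable {G : LuGrp.{v}}

/-- The component at `P ∩ [0, u]` of an element of `Γ(G, u)*`. -/
noncomputable def starFiber (s : starObj (Gam.obj G)) (P : LSpec G) :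
    Chang P.trace.toMVIdeal.Quot := starIncl s P.trace

theorem starFiber_add (s t : starObj (Gam.obj G)) (P : LSpec G) :
    starFiber (s + t) P = starFiber s P + starFiber t P := rfl

theorem starFiber_sup (s t : starObj (Gam.obj G)) (P : LSpec G) :
    starFiber (s ⊔ t) P = starFiber s P ⊔ starFiber t P := rfl

/-- The fiberwise values come from one global element: `x` works for the generator `ı x̂`, and
additivity of Chang's maps handles sums and negatives. -/
theorem exists_forall_chang_eq (s : starObj (Gam.obj G)) :
    ∃ g : G, ∀ P : LSpec G, P.chang (starFiber s P) = P.cls g := by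
  have zero : ∀ P : LSpec G, P.chang 0 = 0 := fun P => by
    have := P.chang_add 0 0
    rw [add_zero] at this
    exact left_eq_add.1 this
  refine star_induction (p := fun s => ∃ g : G, ∀ P : LSpec G,
    P.chang (starFiber s P) = P.cls g) ?_ ?_ ?_ ?_ s
  · intro a
    exact ⟨Subtype.val a, fun P => P.chang_iota _⟩
  · exact ⟨0, zero⟩
  · rintro s t ⟨g, hg⟩ ⟨k, hk⟩
    refine ⟨g + k, fun P => ?_⟩
    rw [starFiber_add, P.chang_add, hg, hk, P.cls_add]
  · rintro s ⟨g, hg⟩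
    refine ⟨-g, fun P => ?_⟩
    have h := P.chang_add (-starFiber s P) (starFiber s P)
    rw [neg_add_cancel, zero, hg] at h
    exact eq_neg_of_add_eq_zero_left h.symm

/-- The map `Γ(G, u)* → G`, given on fibers by Chang's maps. -/
noncomputable def counitFun (s : starObj (Gam.obj G)) : G := (exists_forall_chang_eq s).choose

theorem cls_counitFun (s : starObj (Gam.obj G)) (P : LSpec G) :
    P.cls (counitFun s) = P.chang (starFiber s P) :=
  ((exists_forall_chang_eq s).choose_spec P).symm

theorem counitFun_starGen (x : Seg G) :
    counitFun (starGen (A := Gam.obj G) x) = x.1 :=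
  LSpec.eq_of_forall_cls fun P => (cls_counitFun _ P).trans (P.chang_iota _)

theorem counitFun_add (s t : starObj (Gam.obj G)) :
    counitFun (s + t) = counitFun s + counitFun t :=
  LSpec.eq_of_forall_cls fun P => by
    rw [P.cls_add, cls_counitFun, cls_counitFun, cls_counitFun, starFiber_add, P.chang_add]

/-- Modulo `P`, `υ(s)` is `υ(t)` plus some `g ≥ 0`, so the join with `υ(t)` is again `υ(s)`. The
fibers are chains, so the other case is symmetric. -/
theorem cls_counitFun_sup {s t : starObj (Gam.obj G)} {P : LSpec G}
    (h : starFiber t P ≤ starFiber s P) :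
    P.cls (counitFun (s ⊔ t)) = P.cls (counitFun s ⊔ counitFun t) := by
  have e : starFiber (s ⊔ t) P = starFiber s P := (starFiber_sup s t P).trans (sup_eq_left.2 h)
  obtain ⟨g, hg0, hg⟩ := P.exists_chang_eq_of_nonneg (sub_nonneg.2 h)
  have h1 : P.cls (counitFun s) = P.cls (g + counitFun t) := by
    rw [P.cls_add, ← hg, cls_counitFun, cls_counitFun, ← P.chang_add, sub_add_cancel]
  rw [cls_counitFun, e, P.cls_sup h1, sup_eq_left.2 (le_add_of_nonneg_left hg0), ← h1,
    cls_counitFun]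

theorem counitFun_sup (s t : starObj (Gam.obj G)) :
    counitFun (s ⊔ t) = counitFun s ⊔ counitFun t :=
  LSpec.eq_of_forall_cls fun P => by
    rcases le_total (starFiber t P) (starFiber s P) with h | h
    · exact cls_counitFun_sup h
    · rw [sup_comm, sup_comm (counitFun s)]
      exact cls_counitFun_sup h

/-- Cancel the join in `x ⊓ y + x ⊔ y = x + y`. -/
theorem map_inf_of_map_sup {H K : Type*} [AddCommGroup H] [Lattice H] [IsOrderedAddMonoid H]
    [AddCommGroup K] [Lattice K] [IsOrderedAddMonoid K] (f : H → K)
    (hadd : ∀ x y, f (x + y) = f x + f y) (hsup : ∀ x y, f (x ⊔ y) = f x ⊔ f y) (x y : H) :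
    f (x ⊓ y) = f x ⊓ f y := by
  have h : f (x ⊓ y) + f (x ⊔ y) = f x ⊓ f y + f (x ⊔ y) := by
    rw [← hadd, inf_add_sup, hadd, hsup, inf_add_sup]
  exact add_right_cancel h

variable (G)

/-- The morphism `Γ(G, u)* → (G, u)`. -/
noncomputable def counit : starObj (Gam.obj G) ⟶ G where
  toFun := counitFun
  map_add := counitFun_add
  map_sup := counitFun_sup
  map_inf := map_inf_of_map_sup _ counitFun_add counitFun_sup
  map_unit := (counitFun_starGen (0ᶜ : Seg G)).trans (sub_zero G.unit)

/-- By induction `x ⊓ n u = 0`, from `x ⊓ (n + 1) u ≤ x ⊓ n u + x ⊓ u`; then take `n` with `x ≤ n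
u`. -/
theorem LuGrp.eq_zero_of_inf_unit {x : G} (hx : 0 ≤ x) (h : x ⊓ G.unit = 0) : x = 0 := by
  obtain ⟨n, hn⟩ := G.exists_abs_le x
  have key : ∀ n : ℕ, x ⊓ n • G.unit = 0 := by
    intro n
    induction n with
    | zero => rw [zero_nsmul]; exact inf_eq_right.2 hx
    | succ n ih =>
      refine le_antisymm ?_ (le_inf hx (nsmul_nonneg G.unit_nonneg _))
      have h1 : x ⊓ (n + 1) • G.unit ≤ x ⊓ n • G.unit + x ⊓ G.unit := by
        rw [inf_add, add_inf, add_inf, succ_nsmul]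
        exact le_inf (le_inf (inf_le_left.trans (le_add_of_nonneg_left hx))
          (inf_le_left.trans (le_add_of_nonneg_right G.unit_nonneg)))
          (le_inf (inf_le_left.trans (le_add_of_nonneg_left (nsmul_nonneg G.unit_nonneg n)))
            inf_le_right)
      rwa [ih, h, add_zero] at h1
  rw [← key n]
  exact (inf_eq_left.2 ((le_abs_self x).trans hn)).symm

/-- For `s` in the kernel, `(s ⊔ 0) ⊓ u` is also in the kernel and is some `ı â`, since it lies in
the segment. There `υ` returns `a`, so it vanishes, and `s ⊔ 0 = 0`. -/
theorem counit_injective : Function.Injective (LuHom.toFun (counit G)) := by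
  have key : ∀ s, LuHom.toFun (counit G) s = 0 → s ≤ 0 := by
    intro s hs
    let r := (s ⊔ 0) ⊓ (starObj (Gam.obj G)).unit
    have hr0 : 0 ≤ r := le_inf le_sup_right (starObj (Gam.obj G)).unit_nonneg
    obtain ⟨a, ha⟩ := (starUnitHom_bijective (Gam.obj G)).2 ⟨r, hr0, inf_le_right⟩
    have ha' : starGen a = r := congrArg Subtype.val ha
    have h1 : LuHom.toFun (counit G) r = 0 := by
      show LuHom.toFun (counit G) ((s ⊔ 0) ⊓ (starObj (Gam.obj G)).unit) = 0
      rw [LuHom.map_inf, LuHom.map_sup, hs, LuHom.map_zero, LuHom.map_unit, sup_idem]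
      exact inf_eq_left.2 G.unit_nonneg
    have h2 : Subtype.val a = (0 : G) := (counitFun_starGen a).symm.trans
      ((congrArg (LuHom.toFun (counit G)) ha').trans h1)
    have h3 : a = (0 : Seg G) := Subtype.ext h2
    have h4 : r = 0 := by
      rw [← ha', h3]
      rfl
    have h5 := LuGrp.eq_zero_of_inf_unit _ le_sup_right h4
    exact sup_eq_right.1 h5
  intro s t h
  have h1 : LuHom.toFun (counit G) (s - t) = 0 := by rw [LuHom.map_sub, h, sub_self]
  have h2 : LuHom.toFun (counit G) (t - s) = 0 := by rw [LuHom.map_sub, h, sub_self]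
  exact le_antisymm (sub_nonpos.1 (key _ h1)) (sub_nonpos.1 (key _ h2))

/-- Peel off one unit at a time by `x = (x - u)⁺ + x ⊓ u`, then treat `x⁺` and `x⁻` separately. -/
theorem counit_surjective : Function.Surjective (LuHom.toFun (counit G)) := by
  have key : ∀ (n : ℕ) (x : G), 0 ≤ x → x ≤ n • G.unit →
      ∃ s, LuHom.toFun (counit G) s = x := by
    intro n
    induction n with
    | zero =>
      intro x h0 h1
      rw [zero_nsmul] at h1
      exact ⟨0, (LuHom.map_zero _).trans (le_antisymm h0 h1)⟩
    | succ n ih =>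
      intro x h0 h1
      obtain ⟨s, hs⟩ := ih ((x - G.unit) ⊔ 0) le_sup_right
        (sup_le (by rwa [sub_le_iff_le_add, ← succ_nsmul]) (nsmul_nonneg G.unit_nonneg n))
      refine ⟨s + starGen (A := Gam.obj G) ⟨x ⊓ G.unit, le_inf h0 G.unit_nonneg, inf_le_right⟩, ?_⟩
      rw [LuHom.map_add, hs]
      refine (congrArg _ (counitFun_starGen _)).trans ?_
      have h2 : (x - G.unit) ⊔ 0 = x ⊔ G.unit - G.unit := by rw [sup_sub, sub_self]
      show (x - G.unit) ⊔ 0 + x ⊓ G.unit = x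
      rw [h2, sub_add_eq_add_sub, add_comm (x ⊔ _), inf_add_sup, add_sub_cancel_right]
  intro x
  obtain ⟨n, hn⟩ := G.exists_abs_le x
  obtain ⟨s, hs⟩ := key n (x ⊔ 0) le_sup_right
    (sup_le ((le_abs_self x).trans hn) (nsmul_nonneg G.unit_nonneg n))
  obtain ⟨t, ht⟩ := key n (-x ⊔ 0) le_sup_right
    (sup_le ((neg_le_abs x).trans hn) (nsmul_nonneg G.unit_nonneg n))
  refine ⟨s - t, ?_⟩
  rw [LuHom.map_sub, hs, ht]
  exact posPart_sub_negPart x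

end Counit

/-- A bijective morphism of `l_u`-groups is an isomorphism. -/
noncomputable def LuGrp.isoOfBijective {G H : LuGrp.{v}} (f : G ⟶ H)
    (hf : Function.Bijective (LuHom.toFun f)) : G ≅ H :=
  let e := Equiv.ofBijective _ hf
  have he : ∀ x, LuHom.toFun f (e.symm x) = x := e.apply_symm_apply
  { hom := f
    inv :=
      { toFun := e.symm
        map_add := fun x y => hf.1 (by rw [LuHom.map_add, he, he, he])
        map_sup := fun x y => hf.1 (by rw [LuHom.map_sup, he, he, he])
        map_inf := fun x y => hf.1 (by rw [LuHom.map_inf, he, he, he])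
        map_unit := hf.1 ((he _).trans (LuHom.map_unit f).symm) }
    hom_inv_id := LuHom.ext (funext e.symm_apply_apply)
    inv_hom_id := LuHom.ext (funext he) }

theorem counit_naturality {G H : LuGrp.{v}} (f : G ⟶ H) :
    starMap (Gam.map f) ≫ counit H = counit G ≫ f := by
  refine star_hom_ext fun a => ?_
  show LuHom.toFun (counit H) (LuHom.toFun (starMap (Gam.map f)) (starGen a)) =
    LuHom.toFun f (LuHom.toFun (counit G) (starGen a))
  rw [starMap_starGen]
  exact (counitFun_starGen _).trans (congrArg (LuHom.toFun f) (counitFun_starGen a)).symm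

/-- The natural isomorphism `Γ(G, u)* ≅ (G, u)`. -/
noncomputable def counitIso : Gam.{v} ⋙ starFunctor ≅ 𝟭 LuGrp.{v} :=
  NatIso.ofComponents
    (fun G => LuGrp.isoOfBijective (counit G) ⟨counit_injective G, counit_surjective G⟩)
    counit_naturality

theorem mainTheorem5 :
    -- the fiberwise map `h*` between the products is an `l`-group morphism
    (∀ {A B : MVAlg.{v}} (h : A ⟶ B) (σ τ : ChangProd A),
      prodMap h (σ + τ) = prodMap h σ + prodMap h τ ∧
      prodMap h (σ ⊔ τ) = prodMap h σ ⊔ prodMap h τ ∧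
      prodMap h (σ ⊓ τ) = prodMap h σ ⊓ prodMap h τ) ∧
    -- it restricts to a morphism of `l_u`-groups `h* : A* → B*`
    ∃ map : ∀ {A B : MVAlg.{v}}, (A ⟶ B) → (starObj A ⟶ starObj B),
      (∀ {A B : MVAlg.{v}} (h : A ⟶ B) (s : starObj A),
        starIncl (LuHom.toFun (map h) s) = prodMap h (starIncl s)) ∧
      -- `(-)*` is a functor
      ∃ (map_id : ∀ A : MVAlg.{v}, map (𝟙 A) = 𝟙 (starObj A))
        (map_comp : ∀ {A B C : MVAlg.{v}} (f : A ⟶ B) (g : B ⟶ C), map (f ≫ g) = map f ≫ map g),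
        let star : MVAlg.{v} ⥤ LuGrp.{v} :=
          { obj := starObj, map := map, map_id := map_id, map_comp := map_comp }
        -- `a ↦ ı â` is a natural isomorphism `A ≅ Γ(A*, u)`
        (∃ i : 𝟭 MVAlg.{v} ≅ star ⋙ Gam.{v}, ∀ (A : MVAlg.{v}) (a : A),
          starIncl (Seg.incl (MVHom.toFun (i.hom.app A) a)) = iotaHat a) ∧
        -- the isomorphisms `(m, a) ↦ m u + a` on the fibers determine a natural
        -- isomorphism `υ : Γ(G, u)* ≅ (G, u)`, and `υ (ı x̂) = x`
        (∃ υ : Gam.{v} ⋙ star ≅ 𝟭 LuGrp.{v}, ∀ (G : LuGrp.{v}) (s : starObj (Gam.obj G)),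
          (∀ (P : LSpec G) (m : ℤ) (a : Seg G),
            starIncl s P.trace = Chang.pair m (P.trace.cls a) →
              P.cls (LuHom.toFun (υ.hom.app G) s) = m • P.cls G.unit + P.cls a.incl) ∧
          (∀ x : Seg G, starIncl s = iotaHat x → LuHom.toFun (υ.hom.app G) s = x.incl)) ∧
        -- `Γ` is an equivalence of categories
        Gam.{v}.IsEquivalence := by

  refine ⟨fun h σ τ => ⟨prodMap_add h σ τ, prodMap_sup h σ τ, prodMap_inf h σ τ⟩,
    starMap, fun _ _ => rfl, starFunctor.map_id, starFunctor.map_comp,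
    ⟨starUnitIso, fun _ _ => rfl⟩, ⟨counitIso, fun G s => ⟨fun P m a hs => ?_, fun x hs => ?_⟩⟩,
    -- The two natural isomorphisms suffice; no triangle identity has to be verified for them.
    (CategoryTheory.Equivalence.mk Gam starFunctor counitIso.symm
      starUnitIso.symm).isEquivalence_functor⟩
  · refine (cls_counitFun s P).trans ?_
    exact (congrArg P.chang hs).trans (P.chang_pair m _)
  · obtain rfl : s = starGen x := starIncl_injective hs
    exact counitFun_starGen x
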